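/- Let $p_1, p_2$ be distinct primes and let $\kappa$ be an infinite cardinal. For an abelian group $G$ and a prime $p$ put $p^\omega G=\bigcap_{n<\omega}p^nG$. Let $K_2(\kappa)$ be the class of torsion-free abelian groups $G$ with $|p_1^\omega G|,|p_2^\omega G|\le\kappa$, and for $G_1,G_2\in K_2(\kappa)$ put $G_1\le_{\mathbf K_2}G_2$ if $G_1$ is a pure subgroup of $G_2$, $p_1^\omega G_1=p_1^\omega G_2$, and either $p_2^\omega G_1=p_1^\omega G_1$ or $p_2^\omega G_1=p_2^\omega G_2$. Then $\mathbf K_2(\kappa)=(K_2(\kappa),\le_{\mathbf K_2})$ is an abstract elementary class (in the language $\{+,-,0\}$) with Löwenheim–Skolem number $\operatorname{LS}(\mathbf K_2(\kappa))=\kappa$, such that: 1. If $\kappa=2^\mu$ for some regular uncountable cardinal $\mu$ less than the first measurable cardinal (that is, no cardinal $\nu\le\mu$ is measurable), then $\mathbf K_2(\kappa)$ is not $(<\mu)$-tame: there are $M\in K_2(\kappa)$ infinite and Galois types $p\ne q$ in $\mathbf{gS}(M)$ with $p\upharpoonright A=q\upharpoonright A$ for every $A\subseteq M$ with $|A|<\mu$.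 2. If $\lambda\ge\kappa$ and $\lambda^{\aleph_0}=\lambda$, then $\mathbf K_2(\kappa)$ is almost stable in $\lambda$: for all $M\le_{\mathbf K_2}N$ with $|M|=\lambda$, the set $\{\mathbf{gtp}(b/M;N): b\in N\}$ of Galois types over $M$ realized in $N$ has cardinality at most $\lambda$. 3. $\mathbf K_2(\kappa)$ has no maximal models, but fails joint embedding and fails amalgamation. 4. $\mathbf K_2(\kappa)$ admits intersections: for every $N\in K_2(\kappa)$ and $A\subseteq N$, the intersection of all $M\in K_2(\kappa)$ with $A\subseteq M\le_{\mathbf K_2}N$ belongs to $K_2(\kappa)$ and is $\le_{\mathbf K_2}N$. Here the Galois type $\mathbf{gtp}(b/A;N)$ of $b\in N$ over $A\subseteq N\in K_2(\kappa)$ is the class of the triple $(b,A,N)$ under the transitive closure of the relation that relates $(b_1,A,N_1)$ and $(b_2,A,N_2)$ when there are $N\in K_2(\kappa)$ and $\mathbf K_2$-embeddings $f_i:N_i\to N$ (isomorphisms onto $f_i[N_i]\le_{\mathbf K_2}N$) that are the identity on $A$ and satisfy $f_1(b_1)=f_2(b_2)$; $\mathbf{gS}(M)$ is the set of types $\mathbf{gtp}(b/M;N)$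 with $M\le_{\mathbf K_2}N$ and $b\in N$, and $\mathbf{gtp}(b/M;N)\upharpoonright A=\mathbf{gtp}(b/A;N)$. -/

import Mathlib

open Cardinal

universe u

/-- A class `K` of abelian groups (structures in the finite language `L = {+, -, 0}`) together with
a relation `M ≤_K N` between a group `N` and its subgroups `M`. Since the substructures of an
abelian group in the language `L` are its subgroups, this is the data of a candidate abstract
elementary class of abelian groups; no axiom is imposed here. -/
structure AbGroupClass where
  /-- `Mem G`: the group `G` belongs to `K`. -/
  Mem : (G : Type u) → [AddCommGroup G] → Prop
  /-- `StrongSub N M`: the subgroup `M` of `N` satisfies `M ≤_K N`. -/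
  StrongSub : (N : Type u) → [AddCommGroup N] → AddSubgroup N → Prop

namespace AbGroupClass

variable (K : AbGroupClass.{u})

/-- `S ≤_K T` for two structures `S`, `T` that are subgroups of a common abelian group `G`
(which need not be in `K`). -/
def Le {G : Type u} [AddCommGroup G] (S T : AddSubgroup G) : Prop :=
  S ≤ T ∧ K.StrongSub T (S.addSubgroupOf T)

/-- The Löwenheim-Skolem-Tarski property at the cardinal `lam`. As `L` is finite,
`|L| + ℵ₀ = ℵ₀`. -/
def LSTAt (lam : Cardinal.{u}) : Prop :=
  ℵ₀ ≤ lam ∧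
    ∀ (M : Type u) [AddCommGroup M], K.Mem M → ∀ A : Set M,
      ∃ M₀ : AddSubgroup M, K.StrongSub M M₀ ∧ A ⊆ (M₀ : Set M) ∧ #M₀ ≤ #A + lam

/-- `K` is an abstract elementary class. The structures `M_i` of an increasing chain are taken as
subgroups of some abelian group `G`, arbitrary otherwise; this is no restriction, because the union
of an increasing chain of abelian groups is an abelian group. -/
structure IsAEC : Prop where
  /-- `≤_K` is a relation on `K`. -/
  mem_of_strongSub : ∀ (N : Type u) [AddCommGroup N] (M : AddSubgroup N),
    K.StrongSub N M → K.Mem N ∧ K.Mem M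
  /-- Reflexivity. -/
  refl : ∀ (G : Type u) [AddCommGroup G] (S : AddSubgroup G), K.Mem S → K.Le S S
  /-- Transitivity (antisymmetry holds because `≤_K` refines inclusion). -/
  trans : ∀ (G : Type u) [AddCommGroup G] (R S T : AddSubgroup G),
    K.Le R S → K.Le S T → K.Le R T
  /-- Invariance under isomorphisms. -/
  iso : ∀ (N N' : Type u) [AddCommGroup N] [AddCommGroup N'] (f : N ≃+ N') (M : AddSubgroup N),
    K.StrongSub N M → K.StrongSub N' (M.map f.toAddMonoidHom)
  /-- `K` is closed under isomorphic images. -/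
  mem_iso : ∀ (N N' : Type u) [AddCommGroup N] [AddCommGroup N'] (_ : N ≃+ N'),
    K.Mem N → K.Mem N'
  /-- Coherence. -/
  coherence : ∀ (G : Type u) [AddCommGroup G] (S₀ S₁ S₂ : AddSubgroup G),
    K.Le S₀ S₂ → K.Le S₁ S₂ → S₀ ≤ S₁ → K.Le S₀ S₁
  /-- Tarski-Vaught: unions of increasing chains. -/
  union : ∀ (G : Type u) [AddCommGroup G] (δ : Ordinal.{u}) (S : Ordinal.{u} → AddSubgroup G),
    Order.IsSuccLimit δ → (∀ i < δ, K.Mem (S i)) → (∀ i j, i ≤ j → j < δ → K.Le (S i) (S j)) →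
      K.Mem (⨆ i : Set.Iio δ, S i : AddSubgroup G) ∧
        ∀ i < δ, K.Le (S i) (⨆ j : Set.Iio δ, S j)
  /-- Tarski-Vaught: smoothness. -/
  smooth : ∀ (G : Type u) [AddCommGroup G] (δ : Ordinal.{u}) (S : Ordinal.{u} → AddSubgroup G)
    (T : AddSubgroup G),
    Order.IsSuccLimit δ → (∀ i < δ, K.Mem (S i)) → (∀ i j, i ≤ j → j < δ → K.Le (S i) (S j)) →
      K.Mem T → (∀ i < δ, K.Le (S i) T) → K.Le (⨆ i : Set.Iio δ, S i) T
  /-- The Löwenheim-Skolem-Tarski axiom. -/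
  lst : ∃ lam : Cardinal.{u}, K.LSTAt lam

/-- `LS(K) = κ`: `κ` is the least cardinal with the Löwenheim-Skolem-Tarski property. -/
def HasLSNumber (κ : Cardinal.{u}) : Prop :=
  IsLeast {lam : Cardinal.{u} | K.LSTAt lam} κ

/-- `f : M → N` is a `K`-embedding: an isomorphism onto its image, with `f[M] ≤_K N`. -/
def IsEmbedding {M N : Type u} [AddCommGroup M] [AddCommGroup N] (f : M →+ N) : Prop :=
  Function.Injective f ∧ K.StrongSub N f.range

/-- Every `M ∈ K` has a proper `≤_K`-extension in `K` (up to isomorphism over `M`). -/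
def NoMaximalModels : Prop :=
  ∀ (M : Type u) [AddCommGroup M], K.Mem M →
    ∃ (N : Type u) (_ : AddCommGroup N) (f : M →+ N),
      K.Mem N ∧ K.IsEmbedding f ∧ ¬ Function.Surjective f

/-- Joint embedding. -/
def JointEmbedding : Prop :=
  ∀ (M₁ M₂ : Type u) [AddCommGroup M₁] [AddCommGroup M₂], K.Mem M₁ → K.Mem M₂ →
    ∃ (N : Type u) (_ : AddCommGroup N) (f₁ : M₁ →+ N) (f₂ : M₂ →+ N),
      K.Mem N ∧ K.IsEmbedding f₁ ∧ K.IsEmbedding f₂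

/-- Amalgamation. -/
def Amalgamation : Prop :=
  ∀ (M N₁ N₂ : Type u) [AddCommGroup M] [AddCommGroup N₁] [AddCommGroup N₂],
    K.Mem M → K.Mem N₁ → K.Mem N₂ →
    ∀ (f₁ : M →+ N₁) (f₂ : M →+ N₂), K.IsEmbedding f₁ → K.IsEmbedding f₂ →
      ∃ (N : Type u) (_ : AddCommGroup N) (g₁ : N₁ →+ N) (g₂ : N₂ →+ N),
        K.Mem N ∧ K.IsEmbedding g₁ ∧ K.IsEmbedding g₂ ∧ ∀ m : M, g₁ (f₁ m) = g₂ (f₂ m)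

/-- `cl_K^N(A)`: the intersection of all `M ∈ K` with `A ⊆ M ≤_K N`. -/
def cl (N : Type u) [AddCommGroup N] (A : Set N) : AddSubgroup N :=
  sInf {M : AddSubgroup N | K.Mem M ∧ A ⊆ (M : Set N) ∧ K.StrongSub N M}

/-- `K` admits intersections. -/
def AdmitsIntersections : Prop :=
  ∀ (N : Type u) [AddCommGroup N], K.Mem N → ∀ A : Set N,
    K.Mem (K.cl N A) ∧ K.StrongSub N (K.cl N A)

/-- A triple `(b, A, N)` with `N ∈ K`, `A ⊆ |N|` and `b ∈ N`. The set `A` is a type with an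
injection into `N`, so that the same `A` can be a subset of different groups. -/
structure Triple (A : Type u) where
  N : Type u
  [grp : AddCommGroup N]
  mem : K.Mem N
  incl : A → N
  incl_injective : Function.Injective incl
  b : N

attribute [instance] Triple.grp

variable {K} in
/-- The triple `(b, A', N)` obtained from `(b, A, N)` for a subset `A'` of `A`. -/
def Triple.restrict {A : Type u} (t : K.Triple A) (A' : Set A) : K.Triple A' where
  N := t.N
  mem := t.mem
  incl := fun a => t.incl a
  incl_injective := t.incl_injective.comp Subtype.val_injective
  b := t.b

/-- The relation `E_at`: there are `K`-embeddings of `N₁`, `N₂` into some `N ∈ K` that agree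
on `A` and send `b₁` and `b₂` to the same element. (The group `N` matters up to isomorphism only,
so the common restriction to `A` may be taken to be the identity.) -/
def AtomicEquiv {A : Type u} (t₁ t₂ : K.Triple A) : Prop :=
  ∃ (N : Type u) (_ : AddCommGroup N) (f₁ : t₁.N →+ N) (f₂ : t₂.N →+ N),
    K.Mem N ∧ K.IsEmbedding f₁ ∧ K.IsEmbedding f₂ ∧
      (∀ a : A, f₁ (t₁.incl a) = f₂ (t₂.incl a)) ∧ f₁ t₁.b = f₂ t₂.b

/-- The Galois type `gtp_K(b / A; N)`: the class of the triple `(b, A, N)` under the transitive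
closure of `E_at`. -/
def gtp {A : Type u} (t : K.Triple A) : Set (K.Triple A) :=
  {s | Relation.TransGen K.AtomicEquiv t s}

/-- `gS_K(M; N)`, for `M ≤_K N`: the set of Galois types over `M` of elements of `N`. -/
def gSIn {N : Type u} [AddCommGroup N] (hN : K.Mem N) (M : AddSubgroup N) :
    Set (Set (K.Triple M)) :=
  Set.range fun b : N => K.gtp
    { N := N, mem := hN, incl := Subtype.val, incl_injective := Subtype.val_injective, b := b }

/-- `K` is almost stable in `lam`. -/
def AlmostStableIn (lam : Cardinal.{u}) : Prop :=
  ∀ (N : Type u) [AddCommGroup N] (hN : K.Mem N) (M : AddSubgroup N),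
    K.StrongSub N M → #M = lam → #(K.gSIn hN M) ≤ Cardinal.lift.{u + 1} lam

variable {K} in
/-- The triple `(b, M, N)` has `M ≤_K N` (the inclusion of `M` in `N` is a `K`-embedding), so that
`gtp_K(b / M; N)` is a member of `gS_K(M)`. -/
def Triple.OverModel {M : Type u} [AddCommGroup M] (t : K.Triple M) : Prop :=
  ∃ f : M →+ t.N, K.IsEmbedding f ∧ ∀ m : M, f m = t.incl m

/-- `K` is `(< lam, θ)`-tame: distinct types `p, q ∈ gS_K(M)`, for `M ∈ K` of cardinality `θ`,
have distinct restrictions to some subset of `M` of cardinality `< lam`. -/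
def TameAt (lam θ : Cardinal.{u}) : Prop :=
  ∀ (M : Type u) [AddCommGroup M], K.Mem M → #M = θ →
    ∀ t₁ t₂ : K.Triple M, t₁.OverModel → t₂.OverModel → K.gtp t₁ ≠ K.gtp t₂ →
      ∃ A : Set M, #A < lam ∧ K.gtp (t₁.restrict A) ≠ K.gtp (t₂.restrict A)

/-- `K` is `(< lam)`-tame. -/
def Tame (lam : Cardinal.{u}) : Prop :=
  ∀ θ : Cardinal.{u}, ℵ₀ ≤ θ → K.TameAt lam θ

end AbGroupClass

/-- `M` is a pure subgroup of `N`: `M ∩ nN = nM` for every integer `n` (the inclusion `⊇` always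
holds). -/
def IsPureSubgroup {N : Type u} [AddCommGroup N] (M : AddSubgroup N) : Prop :=
  ∀ (n : ℤ) (x : N), n • x ∈ M → ∃ y ∈ M, n • y = n • x

/-- `p^ω G`, the intersection of the subgroups `p^n G`. -/
def pOmega (p : ℕ) (G : Type u) [AddCommGroup G] : AddSubgroup G :=
  ⨅ n : ℕ, (nsmulAddMonoidHom (α := G) (p ^ n)).range

/-- `G ∈ K₂(p₁, p₂, κ)`: `G` is torsion-free and `p₁^ω G`, `p₂^ω G` have cardinality
at most `κ`. -/
def KTwoMem (p₁ p₂ : ℕ) (κ : Cardinal.{u}) (G : Type u) [AddCommGroup G] : Prop :=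
  IsAddTorsionFree G ∧ #(pOmega p₁ G) ≤ κ ∧ #(pOmega p₂ G) ≤ κ

/-- The pair `K₂(p₁, p₂, κ)` of the class of groups and its relation `≤`. -/
def KTwo (p₁ p₂ : ℕ) (κ : Cardinal.{u}) : AbGroupClass.{u} where
  Mem G := KTwoMem p₁ p₂ κ G
  StrongSub N _ M :=
    KTwoMem p₁ p₂ κ N ∧ KTwoMem p₁ p₂ κ M ∧
    IsPureSubgroup M ∧
    (pOmega p₁ M).map M.subtype = pOmega p₁ N ∧
    (pOmega p₂ M = pOmega p₁ M ∨ (pOmega p₂ M).map M.subtype = pOmega p₂ N)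

/-- `ν` is a measurable cardinal: it is uncountable and there is a `ν`-complete nonprincipal
ultrafilter on a set of cardinality `ν`. -/
def IsMeasurableCardinal (ν : Cardinal.{u}) : Prop :=
  ℵ₀ < ν ∧ ∃ (X : Type u) (U : Ultrafilter X),
    #X = ν ∧ CardinalInterFilter (U : Filter X) ν ∧ ∀ x : X, {x} ∉ U

/-- `μ` is less than the first measurable cardinal (vacuously so if there is no measurable
cardinal): no cardinal `ν ≤ μ` is measurable. -/
def BelowFirstMeasurable (μ : Cardinal.{u}) : Prop :=
  ∀ ν : Cardinal.{u}, ν ≤ μ → ¬ IsMeasurableCardinal ν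

/-! Inside a fixed `N` in the class, `S ≤ N` is strong iff `S` is division-closed, contains `p₁^ω
N`, and either meets `p₂^ω N` exactly in `p₁^ω N` or contains it (`strongSub_iff`). Thus `p₁^ω`
never changes along strong extensions, and `p₂^ω` can grow only while it equals `p₁^ω`; afterwards
it is frozen. This dichotomy gives the chain axioms and the intersections. A pure closure of a set
together with both `p^ω N` gives the Löwenheim-Skolem bound, and a divisible group of size `κ`,
having no proper strong subgroup, shows that it is sharp.

Amalgamation and tameness fail for one reason. For injective `σ : I → I`, embed the free group on
`I` into `ℤ^(I) ⊕ ℤ_(p₁)^(I)` by `e_i ↦ (p₁ e_i, e_{σ i})`. The image is pure and misses `p₂^ω`,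
which is the second summand, while `p₁^ω = 0`, so this is a strong embedding. Modulo `p₁` the image
of `e_i` is `e_{σ i}`; hence every element of `p₂^ω` is congruent modulo `p₁` to an element of the
image iff `σ` is onto. As `p₂^ω` is now frozen, further strong embeddings preserve this property
(`linkedBy_comp_iff`). So `σ = id` and a nonsurjective injection give extensions that cannot be
amalgamated and, with a point of `p₂^ω` adjoined, distinct Galois types. With `|I| = μ`, fewer than
`μ` elements of the base involve fewer than `μ` indices, on which `σ` agrees with a permutation of
`I`; that permutation induces an automorphism identifying the restricted types.

For almost stability, enlarge the base to a pure `M` of size at most `λ` containing both `p^ω N`.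
The type of `b` is determined by the solvable equations `n x = k b + m` with `m ∈ M`
(`gtp_eq_of_solvableEqs_eq`). For each `(n, k)` the good `m` form the empty set or a coset of `M ∩
nN`, so there are at most `λ^ℵ₀ = λ` types. -/

/-! ### Division-closed subgroups -/

/-- A subgroup is division-closed if it contains every `x` with a nonzero multiple in it. In a
torsion-free group this is the same as purity. -/
def IsDivisionClosed {G : Type u} [AddCommGroup G] (M : AddSubgroup G) : Prop :=
  ∀ (n : ℤ) (x : G), n ≠ 0 → n • x ∈ M → x ∈ M

section

variable {G H : Type u} [AddCommGroup G] [AddCommGroup H]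

theorem isPureSubgroup_iff_isDivisionClosed [IsAddTorsionFree G] {M : AddSubgroup G} :
    IsPureSubgroup M ↔ IsDivisionClosed M := by
  constructor
  · intro h n x hn hx
    obtain ⟨y, hy, hyx⟩ := h n x hx
    rwa [← zsmul_right_injective hn hyx]
  · intro h n x hx
    by_cases hn : n = 0
    · exact ⟨0, M.zero_mem, by simp [hn]⟩
    · exact ⟨x, h n x hn hx, rfl⟩

theorem isDivisionClosed_top : IsDivisionClosed (⊤ : AddSubgroup G) :=
  fun _ _ _ _ => trivial

theorem isDivisionClosed_sInf {s : Set (AddSubgroup G)} (h : ∀ M ∈ s, IsDivisionClosed M) :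
    IsDivisionClosed (sInf s) := by
  intro n x hn hx
  rw [AddSubgroup.mem_sInf] at hx ⊢
  exact fun M hM => h M hM n x hn (hx M hM)

/-- The kernel of a homomorphism to a torsion-free group is division-closed. -/
theorem isDivisionClosed_ker [IsAddTorsionFree H] (f : G →+ H) : IsDivisionClosed f.ker := by
  intro n x hn hx
  rw [AddMonoidHom.mem_ker, map_zsmul] at hx
  exact (smul_eq_zero.mp hx).resolve_left hn

theorem isAddTorsionFree_iff_zsmul :
    IsAddTorsionFree G ↔ ∀ (n : ℤ) (x : G), n ≠ 0 → n • x = 0 → x = 0 := by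
  constructor
  · intro _ n x hn hx
    exact (smul_eq_zero.mp hx).resolve_left hn
  · refine fun h => ⟨fun n hn x y hxy => sub_eq_zero.mp (h n _ (by exact_mod_cast hn) ?_)⟩
    have hxy' : n • x = n • y := hxy
    rw [natCast_zsmul, nsmul_sub, hxy', sub_self]

/-- The division closure of the subgroup generated by a set. -/
def pureClosure (s : Set G) : AddSubgroup G where
  carrier := {x | ∃ n : ℤ, n ≠ 0 ∧ n • x ∈ AddSubgroup.closure s}
  zero_mem' := ⟨1, one_ne_zero, by simp⟩
  add_mem' := by
    rintro x y ⟨m, hm, hx⟩ ⟨n, hn, hy⟩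
    refine ⟨m * n, mul_ne_zero hm hn, ?_⟩
    rw [smul_add]
    refine add_mem ?_ ?_
    · rw [mul_comm, mul_smul]
      exact zsmul_mem hx n
    · rw [mul_smul]
      exact zsmul_mem hy m
  neg_mem' := by
    rintro x ⟨m, hm, hx⟩
    exact ⟨m, hm, by rw [smul_neg]; exact neg_mem hx⟩

theorem subset_pureClosure (s : Set G) : s ⊆ pureClosure s :=
  fun x hx => ⟨1, one_ne_zero, by rw [one_smul]; exact AddSubgroup.subset_closure hx⟩

theorem isDivisionClosed_pureClosure (s : Set G) : IsDivisionClosed (pureClosure s) := by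
  rintro n x hn ⟨m, hm, hx⟩
  exact ⟨m * n, mul_ne_zero hm hn, by rwa [mul_smul]⟩

theorem mk_pureClosure_le [IsAddTorsionFree G] (s : Set G) :
    #(pureClosure s) ≤ max #s ℵ₀ := by
  have key : ∀ x : pureClosure s, ∃ c : ℤ × (s →₀ ℤ),
      c.1 ≠ 0 ∧ Finsupp.linearCombination ℤ (Subtype.val : s → G) c.2 = c.1 • (x : G) := by
    rintro ⟨x, n, hn, hx⟩
    rw [← Submodule.span_int_eq_addSubgroupClosure] at hx
    obtain ⟨l, hl⟩ := (Finsupp.mem_span_iff_linearCombination ℤ s _).mp hx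
    exact ⟨(n, l), hn, hl⟩
  -- Torsion-freeness makes the code injective: `x` is the only solution of `n • x = ∑ l`.
  choose c hc hcx using key
  have hinj : Function.Injective c := by
    intro x y hxy
    apply Subtype.ext
    apply zsmul_right_injective (hc x)
    change (c x).1 • (x : G) = (c x).1 • (y : G)
    rw [← hcx x, hxy, hcx y]
  have h1 : #(s →₀ ℤ) ≤ max #s ℵ₀ := by
    rcases isEmpty_or_nonempty s with h | h
    · exact ((Cardinal.mk_le_aleph0_iff).mpr inferInstance).trans (le_max_right _ _)
    · rw [Cardinal.mk_finsupp_lift_of_infinite']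
      simp
  have h2 := Cardinal.mk_le_of_injective hinj
  refine h2.trans ?_
  rw [Cardinal.mk_prod]
  simp only [Cardinal.lift_uzero, Cardinal.mk_int, Cardinal.lift_aleph0]
  exact Cardinal.mul_le_of_le (le_max_right _ _) (le_max_right _ _) h1

/-! ### The subgroups `p^ω G` -/

theorem mem_pOmega {p : ℕ} {x : G} : x ∈ pOmega p G ↔ ∀ n : ℕ, ∃ y : G, p ^ n • y = x := by
  simp [pOmega, AddSubgroup.mem_iInf]

theorem map_mem_pOmega {G H : Type*} [AddCommGroup G] [AddCommGroup H] {p : ℕ} (f : G →+ H) {x : G} (hx : x ∈ pOmega p G) :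
    f x ∈ pOmega p H := by
  rw [mem_pOmega] at hx ⊢
  intro n
  obtain ⟨y, rfl⟩ := hx n
  exact ⟨f y, (map_nsmul f _ _).symm⟩

theorem pOmega_eq_top {p : ℕ} (h : ∀ x : G, ∃ y : G, p • y = x) : pOmega p G = ⊤ := by
  have key : ∀ (n : ℕ) (x : G), ∃ y : G, p ^ n • y = x := by
    intro n
    induction n with
    | zero => exact fun x => ⟨x, by simp⟩
    | succ n ih =>
      intro x
      obtain ⟨y, rfl⟩ := h x
      obtain ⟨z, rfl⟩ := ih y
      exact ⟨z, by rw [pow_succ', mul_smul]⟩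
  exact eq_top_iff.mpr fun x _ => mem_pOmega.mpr fun n => key n x

/-- `p^ω S` for a subgroup `S` of `G`, as a subgroup of `G`. -/
def omegaIn (p : ℕ) (S : AddSubgroup G) : AddSubgroup G := (pOmega p S).map S.subtype

theorem mem_omegaIn {p : ℕ} {S : AddSubgroup G} {x : G} :
    x ∈ omegaIn p S ↔ ∀ n : ℕ, ∃ y ∈ S, p ^ n • y = x := by
  constructor
  · rintro ⟨y, hy, rfl⟩ n
    obtain ⟨z, hz⟩ := mem_pOmega.mp hy n
    exact ⟨z, z.2, congrArg Subtype.val hz⟩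
  · intro h
    obtain ⟨y, hy, hyx⟩ := h 0
    rw [pow_zero, one_smul] at hyx
    subst hyx
    refine ⟨⟨y, hy⟩, ?_, rfl⟩
    rw [SetLike.mem_coe, mem_pOmega]
    intro n
    obtain ⟨z, hz, hzx⟩ := h n
    exact ⟨⟨z, hz⟩, Subtype.ext hzx⟩

theorem omegaIn_le {p : ℕ} (S : AddSubgroup G) : omegaIn p S ≤ S :=
  AddSubgroup.map_subtype_le _

theorem omegaIn_mono {p : ℕ} {S T : AddSubgroup G} (h : S ≤ T) : omegaIn p S ≤ omegaIn p T := by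
  intro x hx
  rw [mem_omegaIn] at hx ⊢
  intro n
  obtain ⟨y, hy, hyx⟩ := hx n
  exact ⟨y, h hy, hyx⟩

theorem mk_omegaIn {p : ℕ} (S : AddSubgroup G) : #(omegaIn p S) = #(pOmega p S) :=
  (Cardinal.mk_congr ((pOmega p S).equivMapOfInjective S.subtype S.subtype_injective).toEquiv).symm

theorem omegaIn_eq_of_isDivisionClosed {p : ℕ} (hp : p ≠ 0) {M : AddSubgroup G}
    (h : IsDivisionClosed M) : omegaIn p M = M ⊓ pOmega p G := by
  ext x
  rw [AddSubgroup.mem_inf, mem_omegaIn, mem_pOmega]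
  constructor
  · intro hx
    obtain ⟨y, hy, hyx⟩ := hx 0
    refine ⟨by simpa [← hyx] using hy, fun n => ?_⟩
    obtain ⟨z, -, hz⟩ := hx n
    exact ⟨z, hz⟩
  · rintro ⟨hx, hdiv⟩ n
    obtain ⟨y, hy⟩ := hdiv n
    refine ⟨y, h ((p ^ n : ℕ) : ℤ) y (by exact_mod_cast pow_ne_zero n hp) ?_, hy⟩
    rwa [natCast_zsmul, hy]

/-- A subgroup `S` of a subgroup `T` is division-closed in `T`. -/
theorem isDivisionClosed_addSubgroupOf {S T : AddSubgroup G} :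
    IsDivisionClosed (S.addSubgroupOf T) ↔ ∀ (n : ℤ), ∀ x ∈ T, n ≠ 0 → n • x ∈ S → x ∈ S :=
  ⟨fun h n x hx hn hnx => h n ⟨x, hx⟩ hn hnx, fun h n x hn hnx => h n x x.2 hn hnx⟩

theorem omegaIn_eq_inf {p : ℕ} (hp : p ≠ 0) {S T : AddSubgroup G} (hST : S ≤ T)
    (h : ∀ (n : ℤ), ∀ x ∈ T, n ≠ 0 → n • x ∈ S → x ∈ S) : omegaIn p S = S ⊓ omegaIn p T := by
  refine le_antisymm (le_inf (omegaIn_le S) (omegaIn_mono hST)) ?_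
  rintro x ⟨hx, hdiv⟩
  rw [mem_omegaIn]
  intro n
  obtain ⟨y, hyT, hy⟩ := mem_omegaIn.mp hdiv n
  refine ⟨y, h ((p ^ n : ℕ) : ℤ) y hyT (by exact_mod_cast pow_ne_zero n hp) ?_, hy⟩
  rw [natCast_zsmul, hy]
  exact hx

theorem pOmega_map_equiv {p : ℕ} (e : G ≃+ H) :
    (pOmega p G).map e.toAddMonoidHom = pOmega p H := by
  apply le_antisymm
  · rintro _ ⟨x, hx, rfl⟩
    exact map_mem_pOmega e.toAddMonoidHom hx
  · intro y hy
    exact ⟨e.symm y, map_mem_pOmega e.symm.toAddMonoidHom hy, e.apply_symm_apply y⟩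

end

/-! ### The relation `≤` of `K₂` -/

section

variable {p₁ p₂ : ℕ} {κ : Cardinal.{u}} {G N M : Type u}
  [AddCommGroup G] [AddCommGroup N] [AddCommGroup M]

theorem KTwoMem.of_injective (f : M →+ N) (hf : Function.Injective f) (hN : KTwoMem p₁ p₂ κ N) :
    KTwoMem p₁ p₂ κ M := by
  have key : ∀ p : ℕ, #(pOmega p M) ≤ #(pOmega p N) := fun p =>
    Cardinal.mk_le_of_injective (f := fun x : pOmega p M =>
      (⟨f x, map_mem_pOmega f x.2⟩ : pOmega p N))
      fun x y hxy => Subtype.ext (hf (congrArg Subtype.val hxy))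
  have := hN.1
  exact ⟨hf.isAddTorsionFree f, (key p₁).trans hN.2.1, (key p₂).trans hN.2.2⟩

theorem KTwoMem.addSubgroup (hN : KTwoMem p₁ p₂ κ N) (S : AddSubgroup N) : KTwoMem p₁ p₂ κ S :=
  hN.of_injective S.subtype S.subtype_injective

/-- Division-closedness gives `p^ω S = S ⊓ p^ω N`, which turns every condition on `p^ω S` into one
about `S` inside `N`. Membership of `S` is then automatic. -/
theorem strongSub_iff (hp₁ : p₁ ≠ 0) (hp₂ : p₂ ≠ 0) {S : AddSubgroup N} :
    (KTwo p₁ p₂ κ).StrongSub N S ↔ KTwoMem p₁ p₂ κ N ∧ IsDivisionClosed S ∧ pOmega p₁ N ≤ S ∧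
      (S ⊓ pOmega p₂ N = pOmega p₁ N ∨ pOmega p₂ N ≤ S) := by
  change (KTwoMem p₁ p₂ κ N ∧ KTwoMem p₁ p₂ κ S ∧ IsPureSubgroup S ∧
    omegaIn p₁ S = pOmega p₁ N ∧
    (pOmega p₂ S = pOmega p₁ S ∨ omegaIn p₂ S = pOmega p₂ N)) ↔ _
  refine and_congr_right fun hN => ?_
  have := hN.1
  rw [isPureSubgroup_iff_isDivisionClosed, and_iff_right (hN.addSubgroup S)]
  refine and_congr_right fun hS => ?_
  have e : pOmega p₂ S = pOmega p₁ S ↔ omegaIn p₂ S = omegaIn p₁ S :=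
    (AddSubgroup.map_injective S.subtype_injective).eq_iff.symm
  rw [e, omegaIn_eq_of_isDivisionClosed hp₁ hS, omegaIn_eq_of_isDivisionClosed hp₂ hS,
    inf_eq_right, inf_eq_right]
  refine and_congr_right fun h1 => ?_
  rw [inf_eq_right.mpr h1]

theorem strongSub_top (hp₁ : p₁ ≠ 0) (hp₂ : p₂ ≠ 0) (hN : KTwoMem p₁ p₂ κ N) :
    (KTwo p₁ p₂ κ).StrongSub N ⊤ :=
  (strongSub_iff hp₁ hp₂).mpr ⟨hN, isDivisionClosed_top, le_top, Or.inr le_top⟩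

/-- The ambient `G` of a chain may have torsion, so division-closedness is required only relative to
`T`. -/
theorem le_iff (hp₁ : p₁ ≠ 0) (hp₂ : p₂ ≠ 0) {S T : AddSubgroup G} :
    (KTwo p₁ p₂ κ).Le S T ↔ S ≤ T ∧ KTwoMem p₁ p₂ κ T ∧
      (∀ (n : ℤ), ∀ x ∈ T, n ≠ 0 → n • x ∈ S → x ∈ S) ∧ omegaIn p₁ T ≤ S ∧
      (S ⊓ omegaIn p₂ T = omegaIn p₁ T ∨ omegaIn p₂ T ≤ S) := by
  refine and_congr_right fun hST => ?_
  rw [strongSub_iff hp₁ hp₂, isDivisionClosed_addSubgroupOf]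
  have e1 : ∀ p : ℕ, pOmega p T ≤ S.addSubgroupOf T ↔ omegaIn p T ≤ S := fun p =>
    (AddSubgroup.map_le_iff_le_comap (f := T.subtype)).symm
  have e2 : S.addSubgroupOf T ⊓ pOmega p₂ T = pOmega p₁ T ↔
      S ⊓ omegaIn p₂ T = omegaIn p₁ T := by
    rw [← (AddSubgroup.map_injective T.subtype_injective).eq_iff,
      AddSubgroup.map_inf _ _ _ T.subtype_injective, AddSubgroup.addSubgroupOf_map_subtype,
      inf_eq_left.mpr hST]
    rfl
  rw [e1, e1, e2]

theorem isEmbedding_equiv (hp₁ : p₁ ≠ 0) (hp₂ : p₂ ≠ 0) (hN : KTwoMem p₁ p₂ κ N) (e : M ≃+ N) :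
    (KTwo p₁ p₂ κ).IsEmbedding e.toAddMonoidHom := by
  refine ⟨e.injective, ?_⟩
  rw [AddMonoidHom.range_eq_top.mpr e.surjective]
  exact strongSub_top hp₁ hp₂ hN

end

/-! ### Increasing chains -/

section

variable {p₁ p₂ : ℕ} {κ : Cardinal.{u}} {G : Type u} [AddCommGroup G]

theorem omegaIn_one_eq_of_le (hp₁ : p₁ ≠ 0) (hp₂ : p₂ ≠ 0) {S T : AddSubgroup G}
    (h : (KTwo p₁ p₂ κ).Le S T) : omegaIn p₁ S = omegaIn p₁ T := by
  obtain ⟨hST, -, hd, h1, -⟩ := (le_iff hp₁ hp₂).mp h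
  rw [omegaIn_eq_inf hp₁ hST hd, inf_eq_right.mpr h1]

/-- The freezing principle: once `p₂^ω` differs from `p₁^ω`, no strong extension enlarges it. -/
theorem omegaIn_two_of_le (hp₁ : p₁ ≠ 0) (hp₂ : p₂ ≠ 0) {S T : AddSubgroup G}
    (h : (KTwo p₁ p₂ κ).Le S T) :
    omegaIn p₂ S = omegaIn p₁ S ∨ omegaIn p₂ S = omegaIn p₂ T := by
  obtain ⟨hST, -, hd, h1, h2⟩ := (le_iff hp₁ hp₂).mp h
  rw [omegaIn_one_eq_of_le hp₁ hp₂ h, omegaIn_eq_inf hp₂ hST hd, inf_eq_right]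
  exact h2

/-- The data of an increasing chain of length a limit ordinal in `K₂`. -/
structure KTwoChain (p₁ p₂ : ℕ) (κ : Cardinal.{u}) (δ : Ordinal.{u})
    (S : Ordinal.{u} → AddSubgroup G) : Prop where
  limit : Order.IsSuccLimit δ
  mem : ∀ i < δ, (KTwo p₁ p₂ κ).Mem (S i)
  le : ∀ i j, i ≤ j → j < δ → (KTwo p₁ p₂ κ).Le (S i) (S j)

namespace KTwoChain

variable {δ : Ordinal.{u}} {S : Ordinal.{u} → AddSubgroup G}

theorem zero_lt (h : KTwoChain p₁ p₂ κ δ S) : 0 < δ := h.limit.bot_lt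

theorem mem_iSup (h : KTwoChain p₁ p₂ κ δ S) {x : G} :
    x ∈ (⨆ i : Set.Iio δ, S i : AddSubgroup G) ↔ ∃ i < δ, x ∈ S i := by
  have : Nonempty (Set.Iio δ) := ⟨⟨0, h.zero_lt⟩⟩
  rw [AddSubgroup.mem_iSup_of_directed]
  · simp
  · intro i j
    refine ⟨max i j, (h.le _ _ ?_ ?_).1, (h.le _ _ ?_ ?_).1⟩
    · exact Subtype.coe_le_coe.mpr (le_max_left i j)
    · exact (max i j).2
    · exact Subtype.coe_le_coe.mpr (le_max_right i j)
    · exact (max i j).2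

theorem le_iSup (h : KTwoChain p₁ p₂ κ δ S) {i : Ordinal.{u}} (hi : i < δ) :
    S i ≤ (⨆ i : Set.Iio δ, S i : AddSubgroup G) :=
  fun _ hx => h.mem_iSup.mpr ⟨i, hi, hx⟩

theorem divisionClosed (hp₁ : p₁ ≠ 0) (hp₂ : p₂ ≠ 0) (h : KTwoChain p₁ p₂ κ δ S)
    {i : Ordinal.{u}} (hi : i < δ) :
    ∀ (n : ℤ), ∀ x ∈ (⨆ i : Set.Iio δ, S i : AddSubgroup G), n ≠ 0 → n • x ∈ S i → x ∈ S i := by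
  intro n x hx hn hnx
  obtain ⟨j, hj, hxj⟩ := h.mem_iSup.mp hx
  obtain ⟨-, -, hd, -⟩ := (le_iff hp₁ hp₂).mp (h.le i (max i j) (le_max_left _ _) (max_lt hi hj))
  exact hd n x ((h.le j (max i j) (le_max_right _ _) (max_lt hi hj)).1 hxj) hn hnx

theorem exists_mem_omegaIn (hp₁ : p₁ ≠ 0) (hp₂ : p₂ ≠ 0) (h : KTwoChain p₁ p₂ κ δ S)
    {p : ℕ} (hp : p ≠ 0) {x : G}
    (hx : x ∈ omegaIn p (⨆ i : Set.Iio δ, S i : AddSubgroup G)) :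
    ∃ i < δ, x ∈ omegaIn p (S i) := by
  obtain ⟨i, hi, hxi⟩ := h.mem_iSup.mp (omegaIn_le _ hx)
  refine ⟨i, hi, ?_⟩
  rw [omegaIn_eq_inf hp (h.le_iSup hi) (h.divisionClosed hp₁ hp₂ hi)]
  exact ⟨hxi, hx⟩

theorem omegaIn_one_iSup (hp₁ : p₁ ≠ 0) (hp₂ : p₂ ≠ 0) (h : KTwoChain p₁ p₂ κ δ S)
    {i : Ordinal.{u}} (hi : i < δ) :
    omegaIn p₁ (⨆ i : Set.Iio δ, S i : AddSubgroup G) = omegaIn p₁ (S i) := by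
  refine le_antisymm (fun x hx => ?_) (omegaIn_mono (h.le_iSup hi))
  obtain ⟨j, hj, hxj⟩ := h.exists_mem_omegaIn hp₁ hp₂ hp₁ hx
  rcases le_total i j with hij | hij
  · rwa [omegaIn_one_eq_of_le hp₁ hp₂ (h.le i j hij hj)]
  · rwa [← omegaIn_one_eq_of_le hp₁ hp₂ (h.le j i hij hi)]

/-- Either `p₂^ω` coincides with `p₁^ω` all along the chain, or it is eventually constant. -/
theorem omegaIn_two_dichotomy (hp₁ : p₁ ≠ 0) (hp₂ : p₂ ≠ 0) (h : KTwoChain p₁ p₂ κ δ S) :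
    (∀ i < δ, omegaIn p₂ (S i) = omegaIn p₁ (S i)) ∨
      ∃ i < δ, omegaIn p₂ (⨆ i : Set.Iio δ, S i : AddSubgroup G) = omegaIn p₂ (S i) := by
  by_contra! hcon
  obtain ⟨⟨i, hi, hne⟩, hcon⟩ := hcon
  refine hcon i hi (le_antisymm (fun x hx => ?_) (omegaIn_mono (h.le_iSup hi)))
  obtain ⟨j, hj, hxj⟩ := h.exists_mem_omegaIn hp₁ hp₂ hp₂ hx
  have hk := max_lt hi hj
  rw [(omegaIn_two_of_le hp₁ hp₂ (h.le i _ (le_max_left i j) hk)).resolve_left hne]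
  exact omegaIn_mono (h.le j _ (le_max_right i j) hk).1 hxj

theorem mem_iSup_class (hp₁ : p₁ ≠ 0) (hp₂ : p₂ ≠ 0) (h : KTwoChain p₁ p₂ κ δ S) :
    KTwoMem p₁ p₂ κ (⨆ i : Set.Iio δ, S i : AddSubgroup G) := by
  have h0 : #(omegaIn p₁ (⨆ i : Set.Iio δ, S i : AddSubgroup G)) ≤ κ := by
    rw [h.omegaIn_one_iSup hp₁ hp₂ h.zero_lt, mk_omegaIn]
    exact (h.mem 0 h.zero_lt).2.1
  refine ⟨?_, (mk_omegaIn _).ge.trans h0, (mk_omegaIn _).ge.trans ?_⟩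
  · rw [isAddTorsionFree_iff_zsmul]
    rintro n ⟨x, hx⟩ hn hnx
    obtain ⟨i, hi, hxi⟩ := h.mem_iSup.mp hx
    have h1 := isAddTorsionFree_iff_zsmul.mp (h.mem i hi).1 n ⟨x, hxi⟩ hn
      (Subtype.ext (Subtype.ext_iff.mp hnx :))
    exact Subtype.ext (Subtype.ext_iff.mp h1 :)
  · rcases h.omegaIn_two_dichotomy hp₁ hp₂ with hall | ⟨i, hi, he⟩
    -- The chain may be longer than `κ`, so summing the bounds would not do; here the union's `p₂^ω`
    -- lies in its `p₁^ω`, which is already bounded.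
    · refine (Cardinal.mk_le_mk_of_subset fun x hx => ?_).trans h0
      obtain ⟨i, hi, hxi⟩ := h.exists_mem_omegaIn hp₁ hp₂ hp₂ hx
      rw [h.omegaIn_one_iSup hp₁ hp₂ hi]
      exact hall i hi ▸ hxi
    · rw [he, mk_omegaIn]
      exact (h.mem i hi).2.2

theorem le_iSup_class (hp₁ : p₁ ≠ 0) (hp₂ : p₂ ≠ 0) (h : KTwoChain p₁ p₂ κ δ S)
    {i : Ordinal.{u}} (hi : i < δ) :
    (KTwo p₁ p₂ κ).Le (S i) (⨆ i : Set.Iio δ, S i : AddSubgroup G) := by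
  refine (le_iff hp₁ hp₂).mpr ⟨h.le_iSup hi, h.mem_iSup_class hp₁ hp₂,
    h.divisionClosed hp₁ hp₂ hi, ?_, ?_⟩
  · rw [h.omegaIn_one_iSup hp₁ hp₂ hi]
    exact omegaIn_le _
  · rcases h.omegaIn_two_dichotomy hp₁ hp₂ with hall | ⟨j, hj, he⟩
    · left
      rw [← omegaIn_eq_inf hp₂ (h.le_iSup hi) (h.divisionClosed hp₁ hp₂ hi), hall i hi,
        h.omegaIn_one_iSup hp₁ hp₂ hi]
    · have hk := max_lt hi hj
      have e : omegaIn p₂ (⨆ i : Set.Iio δ, S i : AddSubgroup G) = omegaIn p₂ (S (max i j)) :=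
        le_antisymm (he ▸ omegaIn_mono (h.le j _ (le_max_right i j) hk).1)
          (omegaIn_mono (h.le_iSup hk))
      obtain ⟨-, -, -, -, h2⟩ := (le_iff hp₁ hp₂).mp (h.le i _ (le_max_left i j) hk)
      rwa [e, h.omegaIn_one_iSup hp₁ hp₂ hk]

theorem iSup_le_class (hp₁ : p₁ ≠ 0) (hp₂ : p₂ ≠ 0) (h : KTwoChain p₁ p₂ κ δ S)
    {T : AddSubgroup G} (hT : KTwoMem p₁ p₂ κ T) (hST : ∀ i < δ, (KTwo p₁ p₂ κ).Le (S i) T) :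
    (KTwo p₁ p₂ κ).Le (⨆ i : Set.Iio δ, S i : AddSubgroup G) T := by
  have hST' := fun i hi => (le_iff hp₁ hp₂).mp (hST i hi)
  refine (le_iff hp₁ hp₂).mpr ⟨?_, hT, ?_, ?_, ?_⟩
  · exact iSup_le fun i => (hST i i.2).1
  · intro n x hx hn hnx
    obtain ⟨i, hi, hxi⟩ := h.mem_iSup.mp hnx
    exact h.le_iSup hi ((hST' i hi).2.2.1 n x hx hn hxi)
  · exact (hST' 0 h.zero_lt).2.2.2.1.trans (h.le_iSup h.zero_lt)
  · by_cases hex : ∃ i < δ, omegaIn p₂ T ≤ S i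
    · obtain ⟨i, hi, h2⟩ := hex
      exact Or.inr (h2.trans (h.le_iSup hi))
    · push Not at hex
      have hall : ∀ i < δ, S i ⊓ omegaIn p₂ T = omegaIn p₁ T := fun i hi =>
        (hST' i hi).2.2.2.2.resolve_right (hex i hi)
      left
      refine le_antisymm ?_ ?_
      · rintro x ⟨hx, hx2⟩
        obtain ⟨i, hi, hxi⟩ := h.mem_iSup.mp hx
        rw [← hall i hi]
        exact ⟨hxi, hx2⟩
      · rw [← hall 0 h.zero_lt]
        exact inf_le_inf_right _ (h.le_iSup h.zero_lt)

end KTwoChain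

end

/-! ### The axioms of abstract elementary classes -/

section

variable {p₁ p₂ : ℕ} {κ : Cardinal.{u}}

theorem kTwo_lstAt (hp₁ : p₁ ≠ 0) (hp₂ : p₂ ≠ 0) (hκ : ℵ₀ ≤ κ) : (KTwo p₁ p₂ κ).LSTAt κ := by
  refine ⟨hκ, fun M _ hM A => ?_⟩
  have := hM.1
  have hsub := subset_pureClosure (A ∪ (pOmega p₁ M ∪ pOmega p₂ M : Set M))
  refine ⟨pureClosure (A ∪ (pOmega p₁ M ∪ pOmega p₂ M : Set M)), ?_, ?_, ?_⟩
  · refine (strongSub_iff hp₁ hp₂).mpr ⟨hM, isDivisionClosed_pureClosure _, ?_, Or.inr ?_⟩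
    · exact fun x hx => hsub (Or.inr (Or.inl hx))
    · exact fun x hx => hsub (Or.inr (Or.inr hx))
  · exact fun x hx => hsub (Or.inl hx)
  · refine (mk_pureClosure_le _).trans (max_le ?_ (hκ.trans (self_le_add_left _ _)))
    refine (mk_union_le _ _).trans (add_le_add le_rfl ((mk_union_le _ _).trans ?_))
    exact (add_le_add hM.2.1 hM.2.2).trans (add_eq_self hκ).le

theorem kTwo_isAEC (hp₁ : p₁ ≠ 0) (hp₂ : p₂ ≠ 0) (hκ : ℵ₀ ≤ κ) : (KTwo p₁ p₂ κ).IsAEC where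
  mem_of_strongSub N _ M h := ⟨h.1, h.2.1⟩
  refl G _ S hS := (le_iff hp₁ hp₂).mpr
    ⟨le_rfl, hS, fun _ _ hx _ _ => hx, omegaIn_le S, Or.inr (omegaIn_le S)⟩
  trans G _ R S T hRS hST := by
    have e1 := omegaIn_one_eq_of_le hp₁ hp₂ hST
    rw [le_iff hp₁ hp₂] at hRS hST ⊢
    obtain ⟨hle, -, hd, h1, h2⟩ := hRS
    obtain ⟨hle', hT, hd', h1', h2'⟩ := hST
    have e2 := omegaIn_eq_inf hp₂ hle' hd'
    refine ⟨hle.trans hle', hT,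
      fun n x hx hn hnx => hd n x (hd' n x hx hn (hle hnx)) hn hnx, e1 ▸ h1, ?_⟩
    rcases h2 with h2 | h2
    · left
      rw [← e1, ← h2, e2, ← inf_assoc, inf_eq_left.mpr hle]
    -- Here `p₂^ω S ≤ R`. If `S` meets `p₂^ω T` only in `p₁^ω T`, so does the smaller `R`; otherwise
    -- `p₂^ω S = p₂^ω T`, which `R` contains.
    · rcases h2' with h2' | h2'
      · left
        rw [e2, h2'] at h2
        rw [← inf_eq_left.mpr hle, inf_assoc, h2', inf_eq_right.mpr h2]
      · right
        rw [e2, inf_eq_right.mpr h2'] at h2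
        exact h2
  iso N N' _ _ f M h := by
    rw [strongSub_iff hp₁ hp₂] at h ⊢
    obtain ⟨hN, hd, h1, h2⟩ := h
    refine ⟨hN.of_injective f.symm.toAddMonoidHom f.symm.injective, ?_, ?_, ?_⟩
    · rintro n x hn ⟨y, hy, hyx⟩
      refine ⟨f.symm x, hd n _ hn ?_, f.apply_symm_apply x⟩
      rw [← map_zsmul, ← hyx]
      simpa using hy
    · rw [← pOmega_map_equiv f]
      exact AddSubgroup.map_mono h1
    · rw [← pOmega_map_equiv f, ← pOmega_map_equiv f, ← AddSubgroup.map_inf _ _ _ f.injective]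
      exact h2.imp (fun h => by rw [h]) fun h => AddSubgroup.map_mono h
  mem_iso N N' _ _ f hN := KTwoMem.of_injective f.symm.toAddMonoidHom f.symm.injective hN
  coherence G _ S₀ S₁ S₂ h02 h12 hle := by
    have e1 := omegaIn_one_eq_of_le hp₁ hp₂ h12
    rw [le_iff hp₁ hp₂] at h02 h12 ⊢
    obtain ⟨-, hT, hd, h1, h2⟩ := h02
    obtain ⟨hle', -, hd', h1', h2'⟩ := h12
    refine ⟨hle, KTwoMem.of_injective (AddSubgroup.inclusion hle')
      (AddSubgroup.inclusion_injective hle') hT, fun n x hx => hd n x (hle' hx), e1 ▸ h1, ?_⟩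
    rw [e1, omegaIn_eq_inf hp₂ hle' hd', ← inf_assoc, inf_eq_left.mpr hle]
    exact h2.imp id fun h => inf_le_right.trans h
  union G _ δ S hδ hmem hle :=
    have h : KTwoChain p₁ p₂ κ δ S := ⟨hδ, hmem, hle⟩
    ⟨h.mem_iSup_class hp₁ hp₂, fun i hi => h.le_iSup_class hp₁ hp₂ hi⟩
  smooth G _ δ S T hδ hmem hle hT hST :=
    have h : KTwoChain p₁ p₂ κ δ S := ⟨hδ, hmem, hle⟩
    h.iSup_le_class hp₁ hp₂ hT hST
  lst := ⟨κ, kTwo_lstAt hp₁ hp₂ hκ⟩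

theorem pOmega_finsupp_rat {p : ℕ} (hp : p ≠ 0) (I : Type u) : pOmega p (I →₀ ℚ) = ⊤ := by
  refine pOmega_eq_top fun x => ⟨(p : ℚ)⁻¹ • x, ?_⟩
  rw [← Nat.cast_smul_eq_nsmul ℚ, smul_smul, mul_inv_cancel₀ (by exact_mod_cast hp), one_smul]

/-- Minimality: a rational vector space of size `κ` equals its own `p₁^ω`, so its only strong
subgroup is itself, even over `A = ∅`. -/
theorem kTwo_hasLSNumber (hp₁ : p₁ ≠ 0) (hp₂ : p₂ ≠ 0) (hκ : ℵ₀ ≤ κ) :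
    (KTwo p₁ p₂ κ).HasLSNumber κ := by
  refine ⟨kTwo_lstAt hp₁ hp₂ hκ, fun lam hlam => ?_⟩
  have hinf : Infinite κ.out := by rwa [Cardinal.infinite_iff, mk_out]
  have hcard : #(κ.out →₀ ℚ) = κ := by
    rw [Cardinal.mk_finsupp_lift_of_infinite]
    simpa using hκ
  have hmem : KTwoMem p₁ p₂ κ (κ.out →₀ ℚ) := by
    refine ⟨inferInstance, ?_, ?_⟩ <;>
    exact (mk_le_of_injective Subtype.val_injective).trans hcard.le
  obtain ⟨M₀, hM₀, -, hle⟩ := hlam.2 _ hmem ∅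
  have htop : (⊤ : AddSubgroup (κ.out →₀ ℚ)) ≤ M₀ := by
    rw [← pOmega_finsupp_rat hp₁]
    exact ((strongSub_iff hp₁ hp₂).mp hM₀).2.2.1
  rw [top_le_iff.mp htop] at hle
  rw [← hcard]
  refine le_trans ?_ (hle.trans (by simp))
  exact mk_le_of_injective (f := fun x => (⟨x, trivial⟩ : (⊤ : AddSubgroup (κ.out →₀ ℚ))))
    fun x y h => congrArg Subtype.val h

/-! ### Intersections -/

theorem kTwo_admitsIntersections (hp₁ : p₁ ≠ 0) (hp₂ : p₂ ≠ 0) :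
    (KTwo p₁ p₂ κ).AdmitsIntersections := by
  intro N _ hN A
  refine ⟨KTwoMem.addSubgroup hN _, (strongSub_iff hp₁ hp₂).mpr ⟨hN, ?_, ?_, ?_⟩⟩
  · exact isDivisionClosed_sInf fun M hM => ((strongSub_iff hp₁ hp₂).mp hM.2.2).2.1
  · exact le_sInf fun M hM => ((strongSub_iff hp₁ hp₂).mp hM.2.2).2.2.1
  -- One member meeting `p₂^ω N` exactly in `p₁^ω N` forces the same for the intersection, since
  -- every member contains `p₁^ω N`. Without such a member, all contain `p₂^ω N`.
  · by_cases hex : ∃ M : AddSubgroup N, (KTwo p₁ p₂ κ).Mem M ∧ A ⊆ (M : Set N) ∧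
        (KTwo p₁ p₂ κ).StrongSub N M ∧ M ⊓ pOmega p₂ N = pOmega p₁ N
    · obtain ⟨M, hM, hA, hs, he⟩ := hex
      left
      refine le_antisymm ?_ (le_inf ?_ (he ▸ inf_le_right))
      · rw [← he]
        exact inf_le_inf_right _ (sInf_le ⟨hM, hA, hs⟩)
      · exact le_sInf fun M hM => ((strongSub_iff hp₁ hp₂).mp hM.2.2).2.2.1
    · right
      refine le_sInf fun M hM => ?_
      exact ((strongSub_iff hp₁ hp₂).mp hM.2.2).2.2.2.resolve_left
        fun he => hex ⟨M, hM.1, hM.2.1, hM.2.2, he⟩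

/-! ### Maximal models and joint embedding -/

theorem pOmega_int {p : ℕ} (hp : p.Prime) : pOmega p ℤ = ⊥ := by
  rw [eq_bot_iff]
  intro x hx
  rw [mem_pOmega] at hx
  rw [AddSubgroup.mem_bot]
  by_contra hne
  have hfin : FiniteMultiplicity (p : ℤ) x :=
    Int.finiteMultiplicity_iff.mpr ⟨by simpa using hp.ne_one, hne⟩
  refine hfin.not_pow_dvd_of_multiplicity_lt (Nat.lt_succ_self _) ?_
  obtain ⟨y, hy⟩ := hx (multiplicity (p : ℤ) x).succ
  exact ⟨y, hy.symm.trans (by simp)⟩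

theorem pOmega_finsupp_eq_bot {p : ℕ} {A : Type*} [AddCommGroup A] (h : pOmega p A = ⊥)
    (I : Type*) : pOmega p (I →₀ A) = ⊥ := by
  rw [eq_bot_iff]
  intro x hx
  rw [AddSubgroup.mem_bot]
  ext i
  have hi : x i ∈ pOmega p A := map_mem_pOmega (Finsupp.applyAddHom i) hx
  rwa [h, AddSubgroup.mem_bot] at hi

end

/-! ### Strong embeddings and `p^ω` -/

section

variable {p₁ p₂ : ℕ} {κ : Cardinal.{u}}

theorem KTwoMem.of_mk_le {G : Type u} [AddCommGroup G] [IsAddTorsionFree G] (h : #G ≤ κ) :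
    KTwoMem p₁ p₂ κ G :=
  ⟨inferInstance, (mk_le_of_injective Subtype.val_injective).trans h,
    (mk_le_of_injective Subtype.val_injective).trans h⟩

/-- A `K₂`-embedding preserves and reflects membership in `p^ω`. -/
theorem mem_pOmega_iff_of_isEmbedding (hp₁ : p₁ ≠ 0) (hp₂ : p₂ ≠ 0) {M N : Type u}
    [AddCommGroup M] [AddCommGroup N] {f : M →+ N} (hf : (KTwo p₁ p₂ κ).IsEmbedding f)
    {p : ℕ} (hp : p ≠ 0) {x : M} : f x ∈ pOmega p N ↔ x ∈ pOmega p M := by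
  refine ⟨fun h => ?_, map_mem_pOmega f⟩
  rw [mem_pOmega] at h ⊢
  intro n
  obtain ⟨y, hy⟩ := h n
  have hd := ((strongSub_iff hp₁ hp₂).mp hf.2).2.1
  obtain ⟨z, rfl⟩ := hd ((p ^ n : ℕ) : ℤ) y (by exact_mod_cast pow_ne_zero n hp)
    (by rw [natCast_zsmul, hy]; exact ⟨x, rfl⟩)
  exact ⟨z, hf.1 (by rw [map_nsmul, hy])⟩

theorem exists_nsmul_of_isEmbedding (hp₁ : p₁ ≠ 0) (hp₂ : p₂ ≠ 0) {M N : Type u}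
    [AddCommGroup M] [AddCommGroup N] {f : M →+ N} (hf : (KTwo p₁ p₂ κ).IsEmbedding f)
    {p : ℕ} (hp : p ≠ 0) {x : M} : (∃ y, f x = p • y) ↔ ∃ y, x = p • y := by
  constructor
  · rintro ⟨y, hy⟩
    have hd := ((strongSub_iff hp₁ hp₂).mp hf.2).2.1
    obtain ⟨z, rfl⟩ := hd (p : ℤ) y (by exact_mod_cast hp)
      (by rw [natCast_zsmul, ← hy]; exact ⟨x, rfl⟩)
    exact ⟨z, hf.1 (by rw [hy, map_nsmul])⟩
  · rintro ⟨y, rfl⟩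
    exact ⟨f y, map_nsmul f _ _⟩

theorem mem_range_of_mem_pOmega_one (hp₁ : p₁ ≠ 0) (hp₂ : p₂ ≠ 0) {M N : Type u}
    [AddCommGroup M] [AddCommGroup N] {f : M →+ N} (hf : (KTwo p₁ p₂ κ).IsEmbedding f)
    {y : N} (hy : y ∈ pOmega p₁ N) : ∃ x ∈ pOmega p₁ M, f x = y := by
  obtain ⟨x, rfl⟩ := ((strongSub_iff hp₁ hp₂).mp hf.2).2.2.1 hy
  exact ⟨x, (mem_pOmega_iff_of_isEmbedding hp₁ hp₂ hf hp₁).mp hy, rfl⟩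

/-- If `p₂^ω M` is not contained in `p₁^ω M`, then `K₂`-embeddings of `M` cannot enlarge it. -/
theorem mem_range_of_mem_pOmega_two (hp₁ : p₁ ≠ 0) (hp₂ : p₂ ≠ 0) {M N : Type u}
    [AddCommGroup M] [AddCommGroup N] {f : M →+ N} (hf : (KTwo p₁ p₂ κ).IsEmbedding f)
    {b : M} (hb₂ : b ∈ pOmega p₂ M) (hb₁ : b ∉ pOmega p₁ M) {y : N} (hy : y ∈ pOmega p₂ N) :
    ∃ x ∈ pOmega p₂ M, f x = y := by
  rcases ((strongSub_iff hp₁ hp₂).mp hf.2).2.2.2 with h | h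
  · refine absurd ((mem_pOmega_iff_of_isEmbedding hp₁ hp₂ hf hp₁).mp ?_) hb₁
    rw [← h]
    exact ⟨⟨b, rfl⟩, map_mem_pOmega f hb₂⟩
  · obtain ⟨x, rfl⟩ := h hy
    exact ⟨x, (mem_pOmega_iff_of_isEmbedding hp₁ hp₂ hf hp₂).mp hy, rfl⟩

/-! ### Maximal models and joint embedding -/

/-- Adding a summand `ℤ` changes neither `p₁^ω` nor `p₂^ω`. The form `PUnit →₀ ℤ` places it in the
right universe. -/
theorem kTwo_noMaximalModels (hp₁ : p₁.Prime) (hp₂ : p₂.Prime) :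
    (KTwo p₁ p₂ κ).NoMaximalModels := by
  intro M _ hM
  have := hM.1
  have hsnd : ∀ p : ℕ, p.Prime → ∀ x ∈ pOmega p (M × (PUnit.{u + 1} →₀ ℤ)), x.2 = 0 := by
    intro p hp x hx
    have h : x.2 ∈ pOmega p (PUnit.{u + 1} →₀ ℤ) := map_mem_pOmega (AddMonoidHom.snd _ _) hx
    rwa [pOmega_finsupp_eq_bot (pOmega_int hp), AddSubgroup.mem_bot] at h
  have hcard : ∀ p : ℕ, p.Prime → #(pOmega p (M × (PUnit.{u + 1} →₀ ℤ))) ≤ #(pOmega p M) :=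
    fun p hp => mk_le_of_injective
      (f := fun x : pOmega p (M × (PUnit.{u + 1} →₀ ℤ)) =>
        (⟨x.1.1, map_mem_pOmega (AddMonoidHom.fst _ _) x.2⟩ : pOmega p M))
      fun x y hxy => Subtype.ext (Prod.ext (congrArg Subtype.val hxy)
        ((hsnd p hp _ x.2).trans (hsnd p hp _ y.2).symm))
  have hN : KTwoMem p₁ p₂ κ (M × (PUnit.{u + 1} →₀ ℤ)) :=
    ⟨inferInstance, (hcard p₁ hp₁).trans hM.2.1, (hcard p₂ hp₂).trans hM.2.2⟩
  have hrange : (AddMonoidHom.inl M (PUnit.{u + 1} →₀ ℤ)).range = (AddMonoidHom.snd _ _).ker := by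
    ext ⟨x, y⟩
    constructor
    · rintro ⟨z, hz⟩
      exact (congrArg Prod.snd hz).symm
    · intro h
      exact ⟨x, Prod.ext rfl (Eq.symm h)⟩
  refine ⟨M × (PUnit.{u + 1} →₀ ℤ), inferInstance, AddMonoidHom.inl _ _, hN, ⟨?_, ?_⟩, ?_⟩
  · exact fun x y hxy => congrArg Prod.fst hxy
  · rw [hrange]
    exact (strongSub_iff hp₁.ne_zero hp₂.ne_zero).mpr ⟨hN, isDivisionClosed_ker _,
      hsnd p₁ hp₁, Or.inr (hsnd p₂ hp₂)⟩
  · intro hsurj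
    obtain ⟨x, hx⟩ := hsurj (0, Finsupp.single PUnit.unit 1)
    have := congrArg (fun y => y.2 PUnit.unit) hx
    simp at this

/-- Strong embeddings preserve `p₁^ω`, which is zero for `ℤ` and everything for `ℚ`. -/
theorem kTwo_not_jointEmbedding (hp₁ : p₁.Prime) (hp₂ : p₂.Prime) (hκ : ℵ₀ ≤ κ) :
    ¬ (KTwo p₁ p₂ κ).JointEmbedding := by
  intro h
  obtain ⟨N, _, f₁, f₂, -, h₁, h₂⟩ := h (PUnit.{u + 1} →₀ ℤ) (PUnit.{u + 1} →₀ ℚ)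
    (KTwoMem.of_mk_le (mk_le_aleph0.trans hκ)) (KTwoMem.of_mk_le (mk_le_aleph0.trans hκ))
  have hx : Finsupp.single PUnit.unit 1 ∈ pOmega p₁ (PUnit.{u + 1} →₀ ℚ) := by
    rw [pOmega_finsupp_rat hp₁.ne_zero]
    trivial
  obtain ⟨y, hy, hyx⟩ :=
    mem_range_of_mem_pOmega_one hp₁.ne_zero hp₂.ne_zero h₁ (map_mem_pOmega f₂ hx)
  rw [pOmega_finsupp_eq_bot (pOmega_int hp₁), AddSubgroup.mem_bot] at hy
  rw [hy, map_zero, ← map_zero f₂] at hyx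
  have := DFunLike.congr_fun (h₂.1 hyx) PUnit.unit
  simp at this

end

/-! ### Rational numbers with denominator prime to `p` -/

/-- The additive group of the rational numbers whose denominator is not divisible by `p`. -/
def pIntegralRat (p : ℕ) [hp : Fact p.Prime] : AddSubgroup ℚ where
  carrier := {q | ¬ p ∣ q.den}
  zero_mem' := by simpa using hp.out.ne_one
  add_mem' := by
    intro a b ha hb h
    exact (hp.out.dvd_mul.mp (h.trans (Rat.add_den_dvd a b))).elim ha hb
  neg_mem' := by
    intro a ha
    simpa using ha

section

variable {p : ℕ} [hp : Fact p.Prime]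

/-- Clearing denominators, `p ^ n` divides `x.num * y.den`, and `y.den` is prime to `p`. -/
theorem pow_dvd_num_of_eq_mul {x y : ℚ} (hy : y ∈ pIntegralRat p) (n : ℕ)
    (h : x = p ^ n * y) : (p : ℤ) ^ n ∣ x.num := by
  have hcop : IsCoprime ((p : ℤ) ^ n) (y.den : ℤ) := by
    apply IsCoprime.pow_left
    rw [Nat.isCoprime_iff_coprime]
    exact (Nat.Prime.coprime_iff_not_dvd hp.out).mpr hy
  apply hcop.dvd_of_dvd_mul_right
  have e : x.num * y.den = p ^ n * y.num * x.den := by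
    have hx : (x.num : ℚ) = x * x.den := (Rat.mul_den_eq_num x).symm
    have hy' : (y.num : ℚ) = y * y.den := (Rat.mul_den_eq_num y).symm
    have : (x.num * y.den : ℚ) = p ^ n * y.num * x.den := by
      rw [hx, hy', h]
      ring
    exact_mod_cast this
  rw [e, mul_assoc]
  exact dvd_mul_right _ _

theorem intCast_mem_pIntegralRat (a : ℤ) : (a : ℚ) ∈ pIntegralRat p := by
  change ¬ p ∣ (a : ℚ).den
  simpa using hp.out.ne_one

theorem pOmega_pIntegralRat_self : pOmega p (pIntegralRat p) = ⊥ := by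
  rw [eq_bot_iff]
  rintro ⟨x, hx⟩ hdiv
  rw [mem_pOmega] at hdiv
  have hnum : x.num ∈ pOmega p ℤ := by
    rw [mem_pOmega]
    intro n
    obtain ⟨y, hy⟩ := hdiv n
    have hxy : x = p ^ n * (y : ℚ) := by
      have := congrArg Subtype.val hy
      simpa using this.symm
    obtain ⟨z, hz⟩ := pow_dvd_num_of_eq_mul y.2 n hxy
    exact ⟨z, by rw [hz]; simp⟩
  rw [pOmega_int hp.out, AddSubgroup.mem_bot, Rat.num_eq_zero] at hnum
  exact Subtype.ext hnum

theorem pOmega_finsupp_pIntegralRat_of_ne {q : ℕ} (hq : q.Prime) (hne : p ≠ q) (I : Type u) :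
    pOmega q (I →₀ pIntegralRat p) = ⊤ := by
  have hdiv : ∀ x : pIntegralRat p, (x : ℚ) / q ∈ pIntegralRat p := by
    rintro ⟨x, hx⟩ h
    have h1 : (x / q).den ∣ x.den * q := by
      rw [div_eq_mul_inv]
      refine (Rat.mul_den_dvd x (q : ℚ)⁻¹).trans (mul_dvd_mul_left _ ?_)
      rw [Rat.inv_natCast_den_of_pos hq.pos]
    exact (hp.out.dvd_mul.mp (h.trans h1)).elim hx
      fun h => hne ((Nat.prime_dvd_prime_iff_eq hp.out hq).mp h)
  refine pOmega_eq_top fun x => ⟨x.mapRange (fun a : pIntegralRat p => (⟨a / q, hdiv a⟩ : pIntegralRat p)) ?_, ?_⟩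
  · exact Subtype.ext (by simp)
  · ext i
    have : (q : ℚ) ≠ 0 := by exact_mod_cast hq.ne_zero
    simp only [Finsupp.coe_smul, Pi.smul_apply, Finsupp.mapRange_apply,
      AddSubgroup.coe_nsmul, nsmul_eq_mul]
    field_simp

/-- Every `p`-integral rational number is congruent modulo `p` to an integer. -/
theorem exists_int_congr (x : pIntegralRat p) : ∃ (z : ℤ) (y : pIntegralRat p),
    (x : ℚ) = z + p * y := by
  have hcop : IsCoprime (x.1.den : ℤ) (p : ℤ) := by
    rw [Nat.isCoprime_iff_coprime]
    exact ((Nat.Prime.coprime_iff_not_dvd hp.out).mpr x.2).symm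
  obtain ⟨a, b, hab⟩ := hcop
  -- Multiply the Bézout identity `a * den + b * p = 1` by `x`.
  refine ⟨x.1.num * a, b • x, ?_⟩
  have hab' : (a : ℚ) * x.1.den + b * p = 1 := by exact_mod_cast hab
  have hx : (x.1.num : ℚ) = x * x.1.den := (Rat.mul_den_eq_num x.1).symm
  rw [Int.cast_mul, hx, AddSubgroup.coe_zsmul, zsmul_eq_mul]
  linear_combination (-(x : ℚ)) * hab'

end

/-! ### Linking a free group with a `p`-integral one -/

/-- The direct sum of a free abelian group and of copies of the `p`-integral rationals. -/
abbrev LinkGroup (p : ℕ) [Fact p.Prime] (I : Type u) : Type u := (I →₀ ℤ) × (I →₀ pIntegralRat p)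

section

variable {p : ℕ} [hp : Fact p.Prime] {I : Type u}

/-- The integers in the `p`-integral rationals. -/
def intToPIntegralRat (p : ℕ) [Fact p.Prime] : ℤ →+ pIntegralRat p where
  toFun a := ⟨a, intCast_mem_pIntegralRat a⟩
  map_zero' := Subtype.ext (by simp)
  map_add' a b := Subtype.ext (by simp)

/-- The embedding of the free group on `I` into `LinkGroup p I` that sends the generator `eᵢ` to
`(p eᵢ, e_{σ i})`. -/
noncomputable def link (p : ℕ) [Fact p.Prime] (σ : I → I) : (I →₀ ℤ) →+ LinkGroup p I :=
  (nsmulAddMonoidHom p).prod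
    ((Finsupp.mapDomain.addMonoidHom σ).comp (Finsupp.mapRange.addMonoidHom (intToPIntegralRat p)))

theorem link_apply (σ : I → I) (x : I →₀ ℤ) :
    link p σ x = (p • x, (x.mapRange (intToPIntegralRat p) (map_zero _)).mapDomain σ) := rfl

theorem link_injective (σ : I → I) : Function.Injective (link p σ) := by
  intro x y hxy
  exact nsmul_right_injective hp.out.ne_zero (congrArg Prod.fst hxy)

theorem snd_link_apply {σ : I → I} (hσ : Function.Injective σ) (x : I →₀ ℤ) (i : I) :
    (((link p σ x).2 (σ i) : pIntegralRat p) : ℚ) = x i := by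
  rw [link_apply, Finsupp.mapDomain_apply hσ, Finsupp.mapRange_apply]
  rfl

theorem snd_link_apply_of_notMem {σ : I → I} (x : I →₀ ℤ) {i : I} (hi : i ∉ Set.range σ) :
    (link p σ x).2 i = 0 := by
  rw [link_apply, Finsupp.mapDomain_of_notMem_range _ _ hi]

/-- If `n (a, y)` is the image of `x`, then `p x_i = n a_i` and `x_i = n y_{σ i}`, so `a_i = p y_{σ
i}`. As `y_{σ i}` is `p`-integral, `p` divides `a_i`, and `a / p` is the preimage of `(a, y)`. -/
theorem isDivisionClosed_range_link {σ : I → I} (hσ : Function.Injective σ) :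
    IsDivisionClosed (link p σ).range := by
  rintro n ⟨a, y⟩ hn ⟨x, hx⟩
  have hx1 : p • x = n • a := congrArg Prod.fst hx
  have hx2 : (link p σ x).2 = n • y := congrArg Prod.snd hx
  have hn' : (n : ℚ) ≠ 0 := by exact_mod_cast hn
  have hdvd : ∀ i, (p : ℤ) ∣ a i := by
    intro i
    have h1 : (p : ℚ) * x i = n * a i := by
      have := DFunLike.congr_fun hx1 i
      simp only [Finsupp.coe_smul, Pi.smul_apply, nsmul_eq_mul, smul_eq_mul] at this
      exact_mod_cast this
    have h2 : (x i : ℚ) = n * (y (σ i) : pIntegralRat p) := by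
      rw [← snd_link_apply (p := p) hσ, hx2]
      simp
    have h3 : ((a i : ℤ) : ℚ) = (p : ℚ) ^ 1 * (y (σ i) : pIntegralRat p) := by
      apply mul_left_cancel₀ hn'
      rw [← h1, h2]
      ring
    simpa using pow_dvd_num_of_eq_mul (y (σ i)).2 1 h3
  have hpz : p • a.mapRange (fun t => t / (p : ℤ)) (by simp) = a := by
    ext i
    simpa using Int.mul_ediv_cancel' (hdvd i)
  set z := a.mapRange (fun t => t / (p : ℤ)) (by simp)
  have hxz : x = n • z := by
    apply nsmul_right_injective hp.out.ne_zero
    change p • x = p • n • z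
    rw [hx1, smul_comm, hpz]
  refine ⟨z, zsmul_right_injective hn ?_⟩
  change n • link p σ z = n • (a, y)
  rw [← map_zsmul, ← hxz, hx]

theorem eq_zero_of_mem_pOmega_self {v : LinkGroup p I} (hv : v ∈ pOmega p (LinkGroup p I)) :
    v = 0 := by
  have h1 : v.1 ∈ pOmega p (I →₀ ℤ) := map_mem_pOmega (AddMonoidHom.fst _ _) hv
  have h2 : v.2 ∈ pOmega p (I →₀ pIntegralRat p) := map_mem_pOmega (AddMonoidHom.snd _ _) hv
  rw [pOmega_finsupp_eq_bot (pOmega_int hp.out)] at h1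
  rw [pOmega_finsupp_eq_bot pOmega_pIntegralRat_self] at h2
  exact Prod.ext h1 h2

theorem mem_pOmega_linkGroup {q : ℕ} (hq : q.Prime) (hne : p ≠ q) {v : LinkGroup p I} :
    v ∈ pOmega q (LinkGroup p I) ↔ v.1 = 0 := by
  constructor
  · intro hv
    have h1 : v.1 ∈ pOmega q (I →₀ ℤ) := map_mem_pOmega (AddMonoidHom.fst _ _) hv
    rwa [pOmega_finsupp_eq_bot (pOmega_int hq)] at h1
  · intro hv
    have h2 : v.2 ∈ pOmega q (I →₀ pIntegralRat p) := by
      rw [pOmega_finsupp_pIntegralRat_of_ne hq hne]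
      trivial
    have h3 := map_mem_pOmega (AddMonoidHom.inr (I →₀ ℤ) (I →₀ pIntegralRat p)) h2
    rwa [show AddMonoidHom.inr (I →₀ ℤ) (I →₀ pIntegralRat p) v.2 = v from
      Prod.ext hv.symm rfl] at h3

/-- A map `g : M → N` links `p₂^ω N` with `M` if every element of `p₂^ω N` is congruent modulo
`p₁ N` to the negative of an element of the image of `g`. -/
def Links (p₁ p₂ : ℕ) {M N : Type u} [AddCommGroup N] (g : M → N) : Prop :=
  ∀ v ∈ pOmega p₂ N, ∃ m : M, ∃ x : N, v + g m = p₁ • x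

theorem links_link {q : ℕ} (hq : q.Prime) (hne : p ≠ q) {σ : I → I}
    (hσ : Function.Surjective σ) : Links p q (link p σ) := by
  have key : ∀ w : I →₀ pIntegralRat p, ∃ m : I →₀ ℤ, ∃ x : LinkGroup p I,
      (0, w) + link p σ m = p • x := by
    intro w
    induction w using Finsupp.induction_linear with
    | zero => exact ⟨0, 0, by simp⟩
    | add w w' ih ih' =>
      obtain ⟨m, x, h⟩ := ih
      obtain ⟨m', x', h'⟩ := ih'
      refine ⟨m + m', x + x', ?_⟩
      rw [smul_add, ← h, ← h', map_add]
      have : ((0, w + w') : LinkGroup p I) = (0, w) + (0, w') := by simp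
      rw [this]
      abel
    | single i r =>
      obtain ⟨i, rfl⟩ := hσ i
      obtain ⟨z, y, hy⟩ := exists_int_congr r
      -- With `r = z + p y`, adding the image of `-z e_i` to `(0, r e_{σ i})` leaves `(-p z e_i, p y
      -- e_{σ i})`.
      refine ⟨Finsupp.single i (-z), (Finsupp.single i (-z), Finsupp.single (σ i) y), ?_⟩
      rw [link_apply, Finsupp.mapRange_single, Finsupp.mapDomain_single, Prod.smul_mk,
        Prod.mk_add_mk, zero_add, ← Finsupp.single_add]
      have hr : r + intToPIntegralRat p (-z) = p • y := by
        apply Subtype.ext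
        have : (r : ℚ) + ((-z : ℤ) : ℚ) = p * y := by
          rw [hy]
          push_cast
          ring
        simpa [intToPIntegralRat] using this
      exact Prod.ext rfl ((congrArg (Finsupp.single (σ i)) hr).trans
        (map_nsmul (Finsupp.singleAddHom (σ i)) p y))
  intro v hv
  rw [mem_pOmega_linkGroup hq hne] at hv
  obtain ⟨m, x, h⟩ := key v.2
  exact ⟨m, x, by rw [← h, show v = (0, v.2) from Prod.ext hv rfl]⟩

theorem not_links_link {q : ℕ} (hq : q.Prime) (hne : p ≠ q) {σ : I → I}
    (hσ : ¬ Function.Surjective σ) : ¬ Links p q (link p σ) := by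
  intro h
  obtain ⟨i, hi⟩ := not_forall.mp hσ
  obtain ⟨m, x, hx⟩ := h (0, Finsupp.single i (intToPIntegralRat p 1))
    ((mem_pOmega_linkGroup hq hne).mpr rfl)
  -- For `i` outside the range of `σ`, the image has no `i`-th coordinate in the second summand, so
  -- `1` would be divisible by `p` in `ℤ_(p)`.
  have h1 := congrArg (fun v : LinkGroup p I => ((v.2 i : pIntegralRat p) : ℚ)) hx
  simp only [Prod.snd_add, Finsupp.add_apply, Finsupp.single_eq_same,
    snd_link_apply_of_notMem m (show i ∉ Set.range σ from hi), add_zero] at h1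
  have h2 : ((1 : ℤ) : ℚ) = (p : ℚ) ^ 1 * (x.2 i : pIntegralRat p) := by
    rw [pow_one, ← nsmul_eq_mul]
    exact h1
  have h3 := pow_dvd_num_of_eq_mul (x.2 i).2 1 h2
  rw [Rat.num_intCast, pow_one] at h3
  exact hp.out.ne_one (by exact_mod_cast Int.eq_one_of_dvd_one (by positivity) h3)

theorem mk_linkGroup_le {κ : Cardinal.{u}} (hκ : ℵ₀ ≤ κ) (hI : #I ≤ κ) : #(LinkGroup p I) ≤ κ := by
  have h1 : ∀ A : Type, ∀ [AddCommGroup A] [Nontrivial A] [Countable A], #(I →₀ A) ≤ κ := by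
    intro A _ _ _
    rcases finite_or_infinite I with h | h
    · exact mk_le_aleph0.trans hκ
    · rw [mk_finsupp_lift_of_infinite]
      refine max_le (by simpa using hI) ?_
      exact (lift_le.mpr (mk_le_aleph0 (α := A))).trans (by simpa using hκ)
  have : Nontrivial (pIntegralRat p) :=
    ⟨intToPIntegralRat p 0, intToPIntegralRat p 1, fun h => by
      simpa [intToPIntegralRat] using congrArg Subtype.val h⟩
  rw [mk_prod, lift_id, lift_id]
  exact mul_le_of_le hκ (h1 ℤ) (h1 (pIntegralRat p))

end

section

variable {p₁ p₂ : ℕ} {κ : Cardinal.{u}} {I : Type u}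

theorem isEmbedding_link [hp₁ : Fact p₁.Prime] (hp₂ : p₂.Prime) (hne : p₁ ≠ p₂) (hκ : ℵ₀ ≤ κ)
    (hI : #I ≤ κ) {σ : I → I} (hσ : Function.Injective σ) :
    (KTwo p₁ p₂ κ).IsEmbedding (link p₁ σ) := by
  refine ⟨link_injective σ, (strongSub_iff hp₁.out.ne_zero hp₂.ne_zero).mpr
    ⟨KTwoMem.of_mk_le (mk_linkGroup_le hκ hI), isDivisionClosed_range_link hσ, ?_, Or.inl ?_⟩⟩
  · intro v hv
    rw [eq_zero_of_mem_pOmega_self hv]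
    exact zero_mem _
  · refine le_antisymm ?_ ?_
    · rintro _ ⟨⟨x, rfl⟩, hx⟩
      have h1 : p₁ • x = 0 := (mem_pOmega_linkGroup hp₂ hne).mp hx
      rw [(smul_eq_zero.mp h1).resolve_left hp₁.out.ne_zero, map_zero]
      exact zero_mem _
    · intro v hv
      rw [eq_zero_of_mem_pOmega_self hv]
      exact zero_mem _

/-- The property of a triple `(b, M, N)` that `b` witnesses `p₂^ω N ⊈ p₁^ω N`, and that `M` links
with `p₂^ω N`. It is invariant under `K₂`-embeddings. -/
def LinkedBy (p₁ p₂ : ℕ) {M N : Type u} [AddCommGroup N] (g : M → N) (b : N) : Prop :=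
  b ∈ pOmega p₂ N ∧ b ∉ pOmega p₁ N ∧ Links p₁ p₂ g

/-- The point `b` freezes `p₂^ω`, so `p₂^ω N'` is the image of `p₂^ω N`; purity of the image lets
divisibility by `p₁` be tested in `N`. -/
theorem linkedBy_comp_iff (hp₁ : p₁ ≠ 0) (hp₂ : p₂ ≠ 0) {M N N' : Type u} [AddCommGroup N]
    [AddCommGroup N'] {f : N →+ N'} (hf : (KTwo p₁ p₂ κ).IsEmbedding f) (g : M → N) (b : N) :
    LinkedBy p₁ p₂ (fun m => f (g m)) (f b) ↔ LinkedBy p₁ p₂ g b := by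
  unfold LinkedBy
  rw [mem_pOmega_iff_of_isEmbedding hp₁ hp₂ hf hp₂, mem_pOmega_iff_of_isEmbedding hp₁ hp₂ hf hp₁]
  refine and_congr_right fun hb₂ => and_congr_right fun hb₁ => ⟨fun h v hv => ?_, fun h v hv => ?_⟩
  · obtain ⟨m, hm⟩ := h (f v) (map_mem_pOmega f hv)
    refine ⟨m, (exists_nsmul_of_isEmbedding hp₁ hp₂ hf hp₁).mp ?_⟩
    rwa [map_add]
  · obtain ⟨w, hw, rfl⟩ := mem_range_of_mem_pOmega_two hp₁ hp₂ hf hb₂ hb₁ hv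
    obtain ⟨m, hm⟩ := h w hw
    refine ⟨m, ?_⟩
    rw [← map_add]
    exact (exists_nsmul_of_isEmbedding hp₁ hp₂ hf hp₁).mpr hm

/-- The element `e_i` of the `p`-integral summand. -/
noncomputable def linkPoint (p : ℕ) [Fact p.Prime] (i : I) : LinkGroup p I :=
  (0, Finsupp.single i (intToPIntegralRat p 1))

theorem linkPoint_mem [hp₁ : Fact p₁.Prime] (hp₂ : p₂.Prime) (hne : p₁ ≠ p₂) (i : I) :
    linkPoint p₁ i ∈ pOmega p₂ (LinkGroup p₁ I) :=
  (mem_pOmega_linkGroup hp₂ hne).mpr rfl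

theorem linkPoint_notMem [hp₁ : Fact p₁.Prime] (i : I) :
    linkPoint p₁ i ∉ pOmega p₁ (LinkGroup p₁ I) := by
  intro h
  have h1 := congrArg (fun v : LinkGroup p₁ I => ((v.2 i : pIntegralRat p₁) : ℚ))
    (eq_zero_of_mem_pOmega_self h)
  simp [linkPoint, intToPIntegralRat] at h1

theorem linkedBy_id [Fact p₁.Prime] (hp₂ : p₂.Prime) (hne : p₁ ≠ p₂) (i : I) :
    LinkedBy p₁ p₂ (link p₁ id) (linkPoint p₁ i) :=
  ⟨linkPoint_mem hp₂ hne i, linkPoint_notMem i, links_link hp₂ hne Function.surjective_id⟩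

theorem kTwo_not_amalgamation (hp₁ : p₁.Prime) (hp₂ : p₂.Prime) (hne : p₁ ≠ p₂) (hκ : ℵ₀ ≤ κ) :
    ¬ (KTwo p₁ p₂ κ).Amalgamation := by
  intro h
  have : Fact p₁.Prime := ⟨hp₁⟩
  have hI : #(ULift.{u} ℕ) ≤ κ := by simpa using hκ
  let σ : ULift.{u} ℕ → ULift.{u} ℕ := fun i => ⟨i.down + 1⟩
  have hinj : Function.Injective σ := fun i j hij => by
    have : i.down + 1 = j.down + 1 := congrArg ULift.down hij
    exact ULift.ext _ _ (by omega)
  have hsurj : ¬ Function.Surjective σ := fun hs => by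
    obtain ⟨i, hi⟩ := hs ⟨0⟩
    exact Nat.succ_ne_zero _ (congrArg ULift.down hi)
  have hL := KTwoMem.of_mk_le (p₁ := p₁) (p₂ := p₂) (mk_linkGroup_le (p := p₁) hκ hI)
  have h1 := isEmbedding_link hp₂ hne hκ hI Function.injective_id
  have h2 := isEmbedding_link hp₂ hne hκ hI hinj
  obtain ⟨N, _, g₁, g₂, -, hg₁, hg₂, hcomm⟩ := h _ _ _
    (hL.of_injective _ h1.1) hL hL (link p₁ id) (link p₁ σ) h1 h2
  have hb := (linkedBy_comp_iff hp₁.ne_zero hp₂.ne_zero hg₁ _ _).mpr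
    (linkedBy_id hp₂ hne (⟨0⟩ : ULift.{u} ℕ))
  -- The witness coming through `g₁` must be pulled back along `g₂`; this is possible because `p₂^ω`
  -- is frozen on that side too.
  obtain ⟨b, -, hb'⟩ := mem_range_of_mem_pOmega_two hp₁.ne_zero hp₂.ne_zero hg₂
    (linkPoint_mem hp₂ hne (⟨0⟩ : ULift.{u} ℕ)) (linkPoint_notMem _) hb.1
  simp only [hcomm, ← hb'] at hb
  exact not_links_link hp₂ hne hsurj
    ((linkedBy_comp_iff hp₁.ne_zero hp₂.ne_zero hg₂ _ _).mp hb).2.2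

/-! ### Galois types -/

theorem AbGroupClass.AtomicEquiv.symm {K : AbGroupClass.{u}} {A : Type u} {s t : K.Triple A}
    (h : K.AtomicEquiv s t) : K.AtomicEquiv t s := by
  obtain ⟨N, i, f, g, hN, hf, hg, hA, hb⟩ := h
  exact ⟨N, i, g, f, hN, hg, hf, fun a => (hA a).symm, hb.symm⟩

theorem AbGroupClass.gtp_eq_of_transGen {K : AbGroupClass.{u}} {A : Type u} {s t : K.Triple A}
    (h : Relation.TransGen K.AtomicEquiv s t) : K.gtp s = K.gtp t := by
  have : Std.Symm (K.AtomicEquiv (A := A)) := ⟨fun _ _ => AbGroupClass.AtomicEquiv.symm⟩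
  have h' : Relation.TransGen K.AtomicEquiv t s := Relation.TransGen.stdSymm.symm _ _ h
  ext r
  exact ⟨fun hr => h'.trans hr, fun hr => h.trans hr⟩

theorem kTwo_atomicEquiv_refl (hp₁ : p₁ ≠ 0) (hp₂ : p₂ ≠ 0) {A : Type u}
    (t : (KTwo p₁ p₂ κ).Triple A) : (KTwo p₁ p₂ κ).AtomicEquiv t t :=
  have h := isEmbedding_equiv hp₁ hp₂ t.mem (AddEquiv.refl t.N)
  ⟨t.N, t.grp, _, _, t.mem, h, h, fun _ => rfl, rfl⟩

theorem kTwo_gtp_eq_iff (hp₁ : p₁ ≠ 0) (hp₂ : p₂ ≠ 0) {A : Type u}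
    {s t : (KTwo p₁ p₂ κ).Triple A} :
    (KTwo p₁ p₂ κ).gtp s = (KTwo p₁ p₂ κ).gtp t ↔
      Relation.TransGen (KTwo p₁ p₂ κ).AtomicEquiv s t := by
  refine ⟨fun h => ?_, AbGroupClass.gtp_eq_of_transGen⟩
  have ht : t ∈ (KTwo p₁ p₂ κ).gtp t := .single (kTwo_atomicEquiv_refl hp₁ hp₂ t)
  rwa [← h] at ht

theorem linkedBy_of_transGen (hp₁ : p₁ ≠ 0) (hp₂ : p₂ ≠ 0) {A : Type u}
    {s t : (KTwo p₁ p₂ κ).Triple A} (h : Relation.TransGen (KTwo p₁ p₂ κ).AtomicEquiv s t)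
    (hs : LinkedBy p₁ p₂ s.incl s.b) : LinkedBy p₁ p₂ t.incl t.b := by
  have step : ∀ s t : (KTwo p₁ p₂ κ).Triple A, (KTwo p₁ p₂ κ).AtomicEquiv s t →
      LinkedBy p₁ p₂ s.incl s.b → LinkedBy p₁ p₂ t.incl t.b := by
    rintro s t ⟨N, _, f, g, -, hf, hg, hA, hb⟩ hs
    rw [← linkedBy_comp_iff hp₁ hp₂ hf] at hs
    simp only [hA, hb] at hs
    exact (linkedBy_comp_iff hp₁ hp₂ hg _ _).mp hs
  induction h with
  | single h => exact step _ _ h hs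
  | tail _ h ih => exact step _ _ h ih

/-! ### Failure of tameness -/

theorem exists_injective_not_surjective (I : Type u) [Infinite I] :
    ∃ σ : I → I, Function.Injective σ ∧ ¬ Function.Surjective σ := by
  have hcard : #(Option I) = #I := by
    rw [mk_option]
    exact add_one_eq (aleph0_le_mk I)
  obtain ⟨e⟩ := Cardinal.eq.mp hcard
  refine ⟨fun i => e (some i), e.injective.comp (Option.some_injective I), fun h => ?_⟩
  obtain ⟨i, hi⟩ := h (e none)
  exact Option.some_ne_none i (e.injective hi)

/-- Supports are finite, so the union has size at most `max #A ℵ₀`. -/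
theorem mk_biUnion_support_lt {μ : Cardinal.{u}} (hμ : ℵ₀ < μ) {A : Set (I →₀ ℤ)}
    (hA : #A < μ) : #(⋃ a ∈ A, (a.support : Set I) : Set I) < μ := by
  refine (mk_biUnion_le _ _).trans_lt ?_
  refine (mul_le_mul_right (ciSup_le' (a := ℵ₀) fun a => ?_) _).trans_lt ?_
  · exact mk_le_aleph0
  · refine (mul_le_max _ _).trans_lt ?_
    exact max_lt (max_lt hA hμ) hμ

/-- The triple given by the embedding `link p₁ σ` and a point `e_i`. -/
noncomputable def linkTriple (p₁ p₂ : ℕ) [Fact p₁.Prime] {κ : Cardinal.{u}} (hκ : ℵ₀ ≤ κ)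
    (hI : #I ≤ κ) (σ : I → I) (i : I) : (KTwo p₁ p₂ κ).Triple (I →₀ ℤ) where
  N := LinkGroup p₁ I
  mem := KTwoMem.of_mk_le (mk_linkGroup_le hκ hI)
  incl := link p₁ σ
  incl_injective := link_injective σ
  b := linkPoint p₁ i

/-- Permuting the second summand by `τ` is an automorphism of the group. It carries `link p₁ id` to
`link p₁ σ` on elements supported where `τ` and `σ` agree. -/
theorem atomicEquiv_restrict_linkTriple [hp₁ : Fact p₁.Prime] (hp₂ : p₂.Prime) (hκ : ℵ₀ ≤ κ)
    (hI : #I ≤ κ) {σ : I → I} (i : I) {A : Set (I →₀ ℤ)} {τ : Equiv.Perm I} (hi : τ i = σ i)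
    (hτ : ∀ a ∈ A, ∀ j ∈ a.support, τ j = σ j) :
    (KTwo p₁ p₂ κ).AtomicEquiv ((linkTriple p₁ p₂ hκ hI id i).restrict A)
      ((linkTriple p₁ p₂ hκ hI σ (σ i)).restrict A) := by
  have hL := KTwoMem.of_mk_le (p₁ := p₁) (p₂ := p₂) (mk_linkGroup_le (p := p₁) hκ hI)
  let e : LinkGroup p₁ I ≃+ LinkGroup p₁ I :=
    (AddEquiv.refl (I →₀ ℤ)).prodCongr (Finsupp.domCongr τ)
  have he : ∀ v, e v = (v.1, v.2.mapDomain τ) := fun v => by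
    rw [← Finsupp.equivMapDomain_eq_mapDomain]
    rfl
  refine ⟨LinkGroup p₁ I, inferInstance, e.toAddMonoidHom,
    (AddEquiv.refl (LinkGroup p₁ I)).toAddMonoidHom, hL,
    isEmbedding_equiv hp₁.out.ne_zero hp₂.ne_zero hL e,
    isEmbedding_equiv hp₁.out.ne_zero hp₂.ne_zero hL _, ?_, ?_⟩
  · rintro ⟨a, ha⟩
    change e (link p₁ id a) = link p₁ σ a
    rw [he, link_apply, link_apply, Finsupp.mapDomain_id]
    refine Prod.ext rfl (Finsupp.mapDomain_congr fun j hj => hτ a ha j ?_)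
    exact Finsupp.support_mapRange (hf := map_zero (intToPIntegralRat p₁)) hj
  · change e (linkPoint p₁ i) = linkPoint p₁ (σ i)
    rw [he, linkPoint, linkPoint, Finsupp.mapDomain_single, hi]

theorem kTwo_not_tame (hp₁ : p₁.Prime) (hp₂ : p₂.Prime) (hne : p₁ ≠ p₂) {μ : Cardinal.{u}}
    (hμ : ℵ₀ < μ) (hκ : μ ≤ κ) : ¬ (KTwo p₁ p₂ κ).Tame μ := by
  intro h
  have : Fact p₁.Prime := ⟨hp₁⟩
  have hκ₀ : ℵ₀ ≤ κ := hμ.le.trans hκ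
  have hinf : Infinite μ.out := by
    rw [infinite_iff, mk_out]
    exact hμ.le
  have hI : #μ.out ≤ κ := by rwa [mk_out]
  obtain ⟨σ, hinj, hsurj⟩ := exists_injective_not_surjective μ.out
  obtain ⟨i⟩ : Nonempty μ.out := inferInstance
  have h1 := isEmbedding_link hp₂ hne hκ₀ hI Function.injective_id
  have h2 := isEmbedding_link hp₂ hne hκ₀ hI hinj
  have hL := KTwoMem.of_mk_le (p₁ := p₁) (p₂ := p₂) (mk_linkGroup_le (p := p₁) hκ₀ hI)
  obtain ⟨A, hA, hne'⟩ := h #(μ.out →₀ ℤ) (aleph0_le_mk _) (μ.out →₀ ℤ) (hL.of_injective _ h1.1)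
    rfl (linkTriple p₁ p₂ hκ₀ hI id i) (linkTriple p₁ p₂ hκ₀ hI σ (σ i)) ⟨link p₁ id, h1, fun _ => rfl⟩
    ⟨link p₁ σ, h2, fun _ => rfl⟩ fun heq =>
      not_links_link hp₂ hne hsurj (linkedBy_of_transGen hp₁.ne_zero hp₂.ne_zero
        ((kTwo_gtp_eq_iff hp₁.ne_zero hp₂.ne_zero).mp heq) (linkedBy_id hp₂ hne i)).2.2
  -- The index `i` is included so that the automorphism also sends the point `e_i` to `e_{σ i}`.
  have hS : #(insert i (⋃ a ∈ A, (a.support : Set μ.out)) : Set μ.out) < #μ.out := by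
    rw [mk_out]
    exact mk_insert_le.trans_lt
      (add_lt_of_lt hμ.le (mk_biUnion_support_lt hμ hA) (one_lt_aleph0.trans hμ))
  obtain ⟨τ, hτ⟩ := extend_function_of_lt (s := insert i (⋃ a ∈ A, (a.support : Set μ.out)))
    ⟨fun j => σ j, hinj.comp Subtype.val_injective⟩ hS ⟨Equiv.refl _⟩
  refine hne' (AbGroupClass.gtp_eq_of_transGen (.single
    (atomicEquiv_restrict_linkTriple hp₂ hκ₀ hI i (τ := τ) ?_ ?_)))
  · exact hτ ⟨i, Set.mem_insert _ _⟩
  · intro a ha j hj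
    exact hτ ⟨j, Set.mem_insert_of_mem _ (Set.mem_biUnion ha hj)⟩

end

/-! ### Almost stability -/

section

variable {N : Type u} [AddCommGroup N]

/-- The integer linear equations `n x = k b + m` over `M` that are solvable in `N`. -/
def solvableEqs (M : AddSubgroup N) (b : N) : Set (ℤ × ℤ × M) :=
  {c | ∃ x : N, c.1 • x = c.2.1 • b + c.2.2}

/-- The set of solvable equations is determined by one equation for each pair of coefficients. -/
theorem exists_code_solvableEqs (M : AddSubgroup N) :
    ∃ F : N → ℤ × ℤ → Option M, ∀ b b', F b = F b' → solvableEqs M b = solvableEqs M b' := by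
  classical
  have key : ∀ b : N, ∃ F : ℤ × ℤ → Option M, ∀ (n k : ℤ) (m : M),
      (n, k, m) ∈ solvableEqs M b ↔
        ∃ m₀ ∈ F (n, k), ∃ x : N, n • x = (m : N) - m₀ := by
    intro b
    have hc : ∀ c : ℤ × ℤ, ∃ o : Option M, ∀ m : M, (c.1, c.2, m) ∈ solvableEqs M b ↔
        ∃ m₀ ∈ o, ∃ x : N, c.1 • x = (m : N) - m₀ := by
      rintro ⟨n, k⟩
      by_cases h : ∃ m₀ : M, (n, k, m₀) ∈ solvableEqs M b
      · obtain ⟨m₀, x₀, hx₀⟩ := h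
        simp only at hx₀
        -- The solvable right-hand sides form the coset of `m₀` modulo `M ∩ nN`, so one solution
        -- determines them all.
        refine ⟨some m₀, fun m => ⟨?_, ?_⟩⟩
        · rintro ⟨x, hx⟩
          simp only at hx
          exact ⟨m₀, rfl, x - x₀, by rw [smul_sub, hx, hx₀]; abel⟩
        · rintro ⟨m₁, hm₁, x, hx⟩
          cases hm₁
          refine ⟨x + x₀, ?_⟩
          simp only at hx ⊢
          rw [smul_add, hx, hx₀]
          abel
      · refine ⟨none, fun m => ⟨fun hm => absurd ⟨m, hm⟩ h, ?_⟩⟩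
        rintro ⟨m₁, hm₁, -⟩
        cases hm₁
    choose F hF using hc
    exact ⟨F, fun n k m => hF (n, k) m⟩
  choose F hF using key
  refine ⟨F, fun b b' h => ?_⟩
  ext ⟨n, k, m⟩
  rw [hF, hF, h]

/-- The graph of the correspondence between the division closures of `M ∪ {b}` and of `M ∪ {b'}`
that fixes `M` and sends `b` to `b'`. -/
def transferGraph (M : AddSubgroup N) (b b' : N) : AddSubgroup (N × N) where
  carrier := {z | ∃ n : ℤ, n ≠ 0 ∧ ∃ k : ℤ, ∃ m ∈ M, n • z.1 = k • b + m ∧ n • z.2 = k • b' + m}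
  zero_mem' := ⟨1, one_ne_zero, 0, 0, M.zero_mem, by simp, by simp⟩
  add_mem' := by
    rintro ⟨x, y⟩ ⟨x', y'⟩ ⟨n, hn, k, m, hm, hx, hy⟩ ⟨n', hn', k', m', hm', hx', hy'⟩
    simp only at hx hy hx' hy'
    refine ⟨n' * n, mul_ne_zero hn' hn, n' * k + n * k', n' • m + n • m',
      add_mem (zsmul_mem hm n') (zsmul_mem hm' n), ?_, ?_⟩
    · calc (n' * n) • (x + x') = n' • n • x + n • n' • x' := by module
        _ = (n' * k + n * k') • b + (n' • m + n • m') := by rw [hx, hx']; module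
    · calc (n' * n) • (y + y') = n' • n • y + n • n' • y' := by module
        _ = (n' * k + n * k') • b' + (n' • m + n • m') := by rw [hy, hy']; module
  neg_mem' := by
    rintro ⟨x, y⟩ ⟨n, hn, k, m, hm, hx, hy⟩
    simp only at hx hy
    refine ⟨n, hn, -k, -m, neg_mem hm, ?_, ?_⟩
    · change n • -x = _
      rw [smul_neg, hx]
      module
    · change n • -y = _
      rw [smul_neg, hy]
      module

theorem swap_mem_transferGraph {M : AddSubgroup N} {b b' x y : N}
    (h : (x, y) ∈ transferGraph M b b') : (y, x) ∈ transferGraph M b' b := by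
  obtain ⟨n, hn, k, m, hm, hx, hy⟩ := h
  exact ⟨n, hn, k, m, hm, hy, hx⟩

theorem diag_mem_transferGraph {M : AddSubgroup N} (b b' : N) {m : N} (hm : m ∈ M) :
    (m, m) ∈ transferGraph M b b' :=
  ⟨1, one_ne_zero, 0, m, hm, by simp, by simp⟩

theorem pair_mem_transferGraph (M : AddSubgroup N) (b b' : N) : (b, b') ∈ transferGraph M b b' :=
  ⟨1, one_ne_zero, 1, 0, M.zero_mem, by simp, by simp⟩

/-- The equations with `n = 0` record the relations `k b + m = 0`; sharing them makes the
correspondence single-valued. -/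
theorem eq_zero_of_mem_transferGraph [IsAddTorsionFree N] {M : AddSubgroup N} {b b' y : N}
    (h : solvableEqs M b = solvableEqs M b') (hy : ((0 : N), y) ∈ transferGraph M b b') :
    y = 0 := by
  obtain ⟨n, hn, k, m, hm, h0, hy⟩ := hy
  have hs : ((0, k, ⟨m, hm⟩) : ℤ × ℤ × M) ∈ solvableEqs M b := ⟨0, by simpa using h0⟩
  rw [h] at hs
  obtain ⟨w, hw⟩ := hs
  simp only [zero_smul] at hw
  exact (smul_eq_zero.mp (hy.trans hw.symm)).resolve_left hn

/-- The equations with nonzero coefficient make the domain of the correspondence division-closed. -/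
theorem exists_mem_transferGraph {M : AddSubgroup N} {b b' x y : N} {n : ℤ} (hn : n ≠ 0)
    (h : solvableEqs M b = solvableEqs M b') (hxy : (n • x, y) ∈ transferGraph M b b') :
    ∃ w, (x, w) ∈ transferGraph M b b' := by
  obtain ⟨q, hq, k, m, hm, hx, -⟩ := hxy
  have hs : ((q * n, k, ⟨m, hm⟩) : ℤ × ℤ × M) ∈ solvableEqs M b := ⟨x, by simpa [mul_smul] using hx⟩
  have hs' := hs
  rw [h] at hs'
  obtain ⟨w, hw⟩ := hs'
  exact ⟨w, q * n, mul_ne_zero hq hn, k, m, hm, by simpa [mul_smul] using hx, hw⟩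

variable {p₁ p₂ : ℕ} {κ : Cardinal.{u}}

theorem isEmbedding_fst_transferGraph (hp₁ : p₁ ≠ 0) (hp₂ : p₂ ≠ 0) (hN : KTwoMem p₁ p₂ κ N)
    {M : AddSubgroup N} (h1 : pOmega p₁ N ≤ M) (h2 : pOmega p₂ N ≤ M) {b b' : N}
    (h : solvableEqs M b = solvableEqs M b') :
    (KTwo p₁ p₂ κ).IsEmbedding
      ((AddMonoidHom.fst N N).comp (transferGraph M b b').subtype) := by
  have := hN.1
  have hle : M ≤ ((AddMonoidHom.fst N N).comp (transferGraph M b b').subtype).range :=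
    fun m hm => ⟨⟨(m, m), diag_mem_transferGraph b b' hm⟩, rfl⟩
  refine ⟨?_, (strongSub_iff hp₁ hp₂).mpr ⟨hN, ?_, h1.trans hle, Or.inr (h2.trans hle)⟩⟩
  · rw [injective_iff_map_eq_zero]
    rintro ⟨⟨x, y⟩, hxy⟩ hx
    obtain rfl : x = 0 := hx
    obtain rfl := eq_zero_of_mem_transferGraph h hxy
    rfl
  · rintro n x hn ⟨⟨⟨x', y⟩, hxy⟩, hx⟩
    obtain rfl : x' = n • x := hx
    obtain ⟨w, hw⟩ := exists_mem_transferGraph hn h hxy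
    exact ⟨⟨(x, w), hw⟩, rfl⟩

theorem isEmbedding_snd_transferGraph (hp₁ : p₁ ≠ 0) (hp₂ : p₂ ≠ 0) (hN : KTwoMem p₁ p₂ κ N)
    {M : AddSubgroup N} (h1 : pOmega p₁ N ≤ M) (h2 : pOmega p₂ N ≤ M) {b b' : N}
    (h : solvableEqs M b = solvableEqs M b') :
    (KTwo p₁ p₂ κ).IsEmbedding
      ((AddMonoidHom.snd N N).comp (transferGraph M b b').subtype) := by
  obtain ⟨hinj, hs⟩ := isEmbedding_fst_transferGraph hp₁ hp₂ hN h1 h2 h.symm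
  constructor
  · rintro ⟨⟨x, y⟩, hxy⟩ ⟨⟨x', y'⟩, hxy'⟩ heq
    have := @hinj ⟨(y, x), swap_mem_transferGraph hxy⟩ ⟨(y', x'), swap_mem_transferGraph hxy'⟩ heq
    simpa [and_comm] using this
  · convert hs using 1
    ext y
    constructor
    · rintro ⟨⟨⟨x, y⟩, hxy⟩, rfl⟩
      exact ⟨⟨(y, x), swap_mem_transferGraph hxy⟩, rfl⟩
    · rintro ⟨⟨⟨x, y⟩, hxy⟩, rfl⟩
      exact ⟨⟨(y, x), swap_mem_transferGraph hxy⟩, rfl⟩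

/-- The graph, with the point `(b, b')`, embeds strongly in `N` by both projections, which links the
two triples in two atomic steps. The larger `M` is needed because `M₀` may miss part of `p₂^ω N`. -/
theorem gtp_eq_of_solvableEqs_eq (hp₁ : p₁ ≠ 0) (hp₂ : p₂ ≠ 0) (hN : (KTwo p₁ p₂ κ).Mem N)
    {M₀ M : AddSubgroup N} (hM : M₀ ≤ M) (h1 : pOmega p₁ N ≤ M) (h2 : pOmega p₂ N ≤ M) {b b' : N}
    (h : solvableEqs M b = solvableEqs M b') :
    (KTwo p₁ p₂ κ).gtp (A := M₀) ⟨N, hN, Subtype.val, Subtype.val_injective, b⟩ =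
      (KTwo p₁ p₂ κ).gtp (A := M₀) ⟨N, hN, Subtype.val, Subtype.val_injective, b'⟩ := by
  have hf := isEmbedding_fst_transferGraph hp₁ hp₂ hN h1 h2 h
  have hg := isEmbedding_snd_transferGraph hp₁ hp₂ hN h1 h2 h
  have hid := isEmbedding_equiv hp₁ hp₂ hN (AddEquiv.refl N)
  let t : (KTwo p₁ p₂ κ).Triple M₀ :=
    { N := transferGraph M b b'
      mem := KTwoMem.of_injective _ hf.1 hN
      incl := fun m => ⟨(m, m), diag_mem_transferGraph b b' (hM m.2)⟩
      incl_injective := fun m m' hmm => Subtype.ext (congrArg (fun z => z.1.1) hmm)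
      b := ⟨(b, b'), pair_mem_transferGraph M b b'⟩ }
  refine AbGroupClass.gtp_eq_of_transGen (.trans (.single (b := t) ?_) (.single ?_))
  · exact ⟨N, _, _, _, hN, hid, hf, fun _ => rfl, rfl⟩
  · exact ⟨N, _, _, _, hN, hg, hid, fun _ => rfl, rfl⟩

theorem kTwo_almostStableIn (hp₁ : p₁ ≠ 0) (hp₂ : p₂ ≠ 0) (hκ : ℵ₀ ≤ κ) {lam : Cardinal.{u}}
    (hlam : lam ^ (ℵ₀ : Cardinal.{u}) = lam) (hle : κ ≤ lam) :
    (KTwo p₁ p₂ κ).AlmostStableIn lam := by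
  intro N _ hN M₀ hM₀ hcard
  have := hN.1
  have hlam₀ : ℵ₀ ≤ lam := hκ.trans hle
  let s : Set N := M₀ ∪ (pOmega p₁ N ∪ pOmega p₂ N : Set N)
  have hsub := subset_pureClosure s
  have hs : #s ≤ lam := by
    refine (mk_union_le _ _).trans (add_le_of_le hlam₀ hcard.le ((mk_union_le _ _).trans ?_))
    exact add_le_of_le hlam₀ (hN.2.1.trans hle) (hN.2.2.trans hle)
  have hM : #(pureClosure s) ≤ lam := (mk_pureClosure_le s).trans (max_le hs hlam₀)
  obtain ⟨F, hF⟩ := exists_code_solvableEqs (pureClosure s)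
  have hcode : #(ℤ × ℤ → Option (pureClosure s)) ≤ lam := by
    have h1 : #(Option (pureClosure s)) ≤ lam := by
      rw [mk_option]
      exact add_le_of_le hlam₀ hM (one_le_aleph0.trans hlam₀)
    rw [mk_pi, prod_const]
    simp only [lift_uzero, mk_eq_aleph0, lift_aleph0]
    exact (power_le_power_right h1).trans hlam.le
  have hinj : ∃ c : (KTwo p₁ p₂ κ).gSIn hN M₀ → ℤ × ℤ → Option (pureClosure s),
      Function.Injective c := by
    choose g hg using fun q : (KTwo p₁ p₂ κ).gSIn hN M₀ => q.2
    refine ⟨fun q => F (g q), fun q r hqr => Subtype.ext ?_⟩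
    rw [← hg q, ← hg r]
    exact gtp_eq_of_solvableEqs_eq hp₁ hp₂ hN (fun x hx => hsub (Or.inl hx))
      (fun x hx => hsub (Or.inr (Or.inl hx))) (fun x hx => hsub (Or.inr (Or.inr hx))) (hF _ _ hqr)
  obtain ⟨c, hc⟩ := hinj
  -- Types are classes of triples and live one universe higher, hence the lifts.
  have h1 := lift_mk_le_lift_mk_of_injective hc
  have h2 : lift.{u + 1} #(ℤ × ℤ → Option (pureClosure s)) ≤ lift.{u + 1} lam := lift_le.mpr hcode
  rw [lift_id'.{u, u + 1}] at h1
  exact h1.trans h2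

end

theorem theorem4p3 (p₁ p₂ : ℕ) (hp₁ : p₁.Prime) (hp₂ : p₂.Prime) (hne : p₁ ≠ p₂)
    (κ : Cardinal.{u}) (hκ : ℵ₀ ≤ κ) :
    (KTwo p₁ p₂ κ).IsAEC ∧
    (KTwo p₁ p₂ κ).HasLSNumber κ ∧
    (∀ μ : Cardinal.{u}, μ.IsRegular → ℵ₀ < μ → BelowFirstMeasurable μ → κ = 2 ^ μ →
      ¬ (KTwo p₁ p₂ κ).Tame μ) ∧
    (∀ lam : Cardinal.{u}, lam ^ (ℵ₀ : Cardinal.{u}) = lam → κ ≤ lam →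
      (KTwo p₁ p₂ κ).AlmostStableIn lam) ∧
    (KTwo p₁ p₂ κ).NoMaximalModels ∧
    ¬ (KTwo p₁ p₂ κ).JointEmbedding ∧
    ¬ (KTwo p₁ p₂ κ).Amalgamation ∧
    (KTwo p₁ p₂ κ).AdmitsIntersections := by
  have h₁ := hp₁.ne_zero
  have h₂ := hp₂.ne_zero
  exact ⟨kTwo_isAEC h₁ h₂ hκ, kTwo_hasLSNumber h₁ h₂ hκ,
    fun μ _ hμ _ he => kTwo_not_tame hp₁ hp₂ hne hμ (he ▸ (cantor μ).le),
    fun lam hlam hle => kTwo_almostStableIn h₁ h₂ hκ hlam hle,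
    kTwo_noMaximalModels hp₁ hp₂, kTwo_not_jointEmbedding hp₁ hp₂ hκ,
    kTwo_not_amalgamation hp₁ hp₂ hne hκ, kTwo_admitsIntersections h₁ h₂⟩
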